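/- **Theorem 3.1.** Let $n\ge 3$, let $\widetilde M(c)$ be a real space form of dimension $m$, i.e. a smooth Riemannian manifold $(\widetilde M,\widetilde g)$ of dimension $m$ all of whose sectional curvatures are equal to $c\in\mathbb R$, and let $(M,g)$ be a smooth Riemannian manifold of dimension $n$, isometrically immersed in $\widetilde M(c)$, with second fundamental form $h$, mean curvature vector $H=\frac1n\sum_{i=1}^n h(e_i,e_i)$ ($\{e_1,\dots,e_n\}$ an orthonormal frame of $T_xM$) and Weingarten operators $A_\xi$, $g(A_\xi X,Y)=\widetilde g(h(X,Y),\xi)$. For $x\in M$ let $k$ denote the sectional curvature of $M$ on the planes of $T_xM$ and let $\tau=\sum_{1\le i<j\le n}k(e_i\wedge e_j)$ be the scalar curvature at $x$. For $a\in(-1,1)$ put $$\delta^a_M=\begin{cases}\tau-a\min k, & 0\le a<1,\\ \tau-a\max k, & -1<a<0.\end{cases}$$ Then, for every $a\in(-1,1)$ and at every point $x\in M$, $$\delta^a_M\le\frac{(n^2-n-2a)c}{2}+\frac{n(a+1)-3a-1}{n(a+1)-2a}\cdot\frac{n^2\|H\|^2}{2}.$$ Equality holds at $x$ if and only if there are an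 orthonormal frame $\{e_1,\dots,e_n\}$ of $T_xM$ and an orthonormal frame $\{e_{n+1},\dots,e_m\}$ of the normal space $T_x^\perp M$ such that, for every $r\in\{n+1,\dots,m\}$, the matrix $(h^r_{ij})$ of $A_r=A_{e_r}$ in the frame $\{e_1,\dots,e_n\}$ is diagonal and $$(a+1)h^r_{11}=(a+1)h^r_{22}=h^r_{33}=\dots=h^r_{nn}.$$ -/

import Mathlib

open scoped Manifold ContDiff

set_option maxSynthPendingDepth 3

noncomputable section

/-! ### Riemannian geometry of a metric on an open piece of a vector space

`G y` is the matrix of the metric at `y`; vectors are constant (coordinate) vector fields. -/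

section Coordinates

variable {E : Type*} [NormedAddCommGroup E] [NormedSpace ℝ E]

/-- Christoffel symbols of the first kind, from `D = dG` at a point:
`(u, v, w) ↦ (D u v w + D v u w - D w u v) / 2`. -/
def christoffelFirst (D : E →L[ℝ] E →L[ℝ] E →L[ℝ] ℝ) : E →L[ℝ] E →L[ℝ] E →L[ℝ] ℝ :=
  let D' : E →L[ℝ] E →L[ℝ] E →L[ℝ] ℝ := D.flip
  let T : (E →L[ℝ] E →L[ℝ] ℝ) →L[ℝ] E →L[ℝ] E →L[ℝ] ℝ := ContinuousLinearMap.flipₗᵢ ℝ E E ℝ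
  let S : E →L[ℝ] E →L[ℝ] E →L[ℝ] ℝ := D + D' - T.comp D'
  (1 / 2 : ℝ) • S

theorem christoffelFirst_apply (D : E →L[ℝ] E →L[ℝ] E →L[ℝ] ℝ) (u v w : E) :
    christoffelFirst D u v w = 1 / 2 * (D u v w + D v u w - D w u v) := by
  simp [christoffelFirst]

/-- Christoffel symbols `Γ(u, v) = ∇_u v` (`u`, `v` coordinate fields) of the Levi-Civita connection
of `G`: the first index of the symbols of the first kind is raised with the inverse of `G y`. -/
def christoffel (G : E → E →L[ℝ] E →L[ℝ] ℝ) (y : E) : E →L[ℝ] E →L[ℝ] E :=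
  (ContinuousLinearMap.compL ℝ E (E →L[ℝ] ℝ) E (G y).inverse).comp
    (christoffelFirst (fderiv ℝ G y))

/-- The curvature `R(u, v) w = ∇_u ∇_v w - ∇_v ∇_u w` of `G` at `y` (`u`, `v`, `w` coordinate
fields). -/
def curvature (G : E → E →L[ℝ] E →L[ℝ] ℝ) (y u v w : E) : E :=
  fderiv ℝ (christoffel G) y u v w - fderiv ℝ (christoffel G) y v u w
    + christoffel G y u (christoffel G y v w) - christoffel G y v (christoffel G y u w)

end Coordinates

/-! ### Riemannian manifolds -/

section Manifolds

variable {E : Type*} [NormedAddCommGroup E] [NormedSpace ℝ E]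
  {M : Type*} [TopologicalSpace M] [ChartedSpace E M] [IsManifold 𝓘(ℝ, E) ∞ M]

variable (E M) in
/-- A smooth Riemannian metric on the manifold `M` modelled on `E`. -/
abbrev SmoothMetric : Type _ :=
  Bundle.ContMDiffRiemannianMetric 𝓘(ℝ, E) ∞ E (fun x : M => TangentSpace 𝓘(ℝ, E) x)

/-- The metric in the coordinates of the preferred chart at `x`, as a function of the point `y` of
the chart's target. (The tangent space at `x` is identified by Mathlib with `E` through this very
chart, so that vectors at `x` are equal to their coordinates.) -/
def metricInChart (g : SmoothMetric E M) (x : M) (y : E) : E →L[ℝ] E →L[ℝ] ℝ :=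
  let b : E →L[ℝ] E →L[ℝ] ℝ := g.inner ((extChartAt 𝓘(ℝ, E) x).symm y)
  let d : E →L[ℝ] E := mfderiv 𝓘(ℝ, E) 𝓘(ℝ, E) (extChartAt 𝓘(ℝ, E) x).symm y
  b.bilinearComp d d

/-- The curvature tensor at `x`. -/
def curvatureTensor (g : SmoothMetric E M) (x : M) (u v w : TangentSpace 𝓘(ℝ, E) x) :
    TangentSpace 𝓘(ℝ, E) x :=
  curvature (E := E) (metricInChart g x) (extChartAt 𝓘(ℝ, E) x x) u v w

/-- The sectional curvature of the plane at `x` spanned by the orthonormal vectors `u`, `v`. -/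
def sectionalCurvature (g : SmoothMetric E M) (x : M) (u v : TangentSpace 𝓘(ℝ, E) x) : ℝ :=
  g.inner x (curvatureTensor g x u v v) u

/-- `e` is an orthonormal family of tangent vectors at `x`. -/
def IsOrthonormal {ι : Type*} (g : SmoothMetric E M) (x : M)
    (e : ι → TangentSpace 𝓘(ℝ, E) x) : Prop :=
  (∀ i, g.inner x (e i) (e i) = 1) ∧ ∀ i j, i ≠ j → g.inner x (e i) (e j) = 0

/-- The values of the sectional curvature on the planes of the tangent space at `x`. -/
def sectionalCurvatures (g : SmoothMetric E M) (x : M) : Set ℝ :=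
  {k | ∃ u v : TangentSpace 𝓘(ℝ, E) x, IsOrthonormal g x ![u, v] ∧ k = sectionalCurvature g x u v}

/-- `(M, g)` is a real space form of curvature `c`: all its sectional curvatures are equal to `c`.
Neither completeness nor connectedness is required. -/
def IsSpaceForm (g : SmoothMetric E M) (c : ℝ) : Prop :=
  ∀ (x : M) (u v : TangentSpace 𝓘(ℝ, E) x),
    IsOrthonormal g x ![u, v] → sectionalCurvature g x u v = c

/-- Every tangent space has an orthonormal frame. -/
theorem exists_isOrthonormal [FiniteDimensional ℝ E] (g : SmoothMetric E M) (x : M) :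
    ∃ e : Fin (Module.finrank ℝ E) → TangentSpace 𝓘(ℝ, E) x, IsOrthonormal g x e := by
  let B : LinearMap.BilinForm ℝ E :=
    LinearMap.mk₂ ℝ (fun u v : E => g.inner x u v)
      (fun _ _ _ => by erw [map_add]; rfl) (fun _ _ _ => by erw [map_smul]; rfl)
      (fun u v w => map_add (g.inner x u) v w) (fun c u v => map_smul (g.inner x u) c v)
  obtain ⟨v, hv⟩ := LinearMap.BilinForm.exists_orthogonal_basis (B := B)
    ⟨fun u w => g.symm x u w⟩
  have hpos : ∀ i, 0 < B (v i) (v i) := fun i => g.pos x (v i) (v.ne_zero i)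
  have key : ∀ i j, B ((√(B (v i) (v i)))⁻¹ • v i) ((√(B (v j) (v j)))⁻¹ • v j)
      = (√(B (v i) (v i)))⁻¹ * ((√(B (v j) (v j)))⁻¹ * B (v i) (v j)) := by
    intro i j
    simp only [map_smul, LinearMap.smul_apply, smul_eq_mul]
    ring
  refine ⟨fun i => ((√(B (v i) (v i)))⁻¹ • v i : E), fun i => ?_, fun i j hij => ?_⟩
  · refine (key i i).trans ?_
    have h1 := Real.mul_self_sqrt (hpos i).le
    have h2 := (Real.sqrt_pos.2 (hpos i)).ne'
    field_simp
    nlinarith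
  · refine (key i j).trans ?_
    rw [show B (v i) (v j) = 0 from hv hij]
    simp

/-- An orthonormal frame of the tangent space at `x`. -/
def orthonormalFrame [FiniteDimensional ℝ E] (g : SmoothMetric E M) (x : M) :
    Fin (Module.finrank ℝ E) → TangentSpace 𝓘(ℝ, E) x :=
  (exists_isOrthonormal g x).choose

/-- The scalar curvature `τ = ∑_{i < j} R(e_i, e_j, e_i, e_j)` at `x`, the sum of the sectional
curvatures of the coordinate planes of an orthonormal frame. -/
def scalarCurvature [FiniteDimensional ℝ E] (g : SmoothMetric E M) (x : M) : ℝ :=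
  ∑ i, ∑ j ∈ Finset.Ioi i,
    sectionalCurvature g x (orthonormalFrame g x i) (orthonormalFrame g x j)

/-- The sectional curvature has a minimum and a maximum on the planes at `x`. -/
theorem exists_isLeast_isGreatest_sectionalCurvatures [FiniteDimensional ℝ E]
    (hE : 2 ≤ Module.finrank ℝ E) (g : SmoothMetric E M) (x : M) :
    (∃ k, IsLeast (sectionalCurvatures g x) k) ∧ ∃ k, IsGreatest (sectionalCurvatures g x) k := by
  let b : E →L[ℝ] E →L[ℝ] ℝ := g.inner x
  let K : Set (E × E) := {p | b p.1 p.1 = 1 ∧ b p.2 p.2 = 1 ∧ b p.1 p.2 = 0}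
  have hort : ∀ u v : E, IsOrthonormal g x ![u, v] ↔ (u, v) ∈ K := by
    intro u v
    have hs : b v u = b u v := g.symm x v u
    constructor
    · rintro ⟨h1, h2⟩
      exact ⟨h1 0, h1 1, h2 0 1 (by decide)⟩
    · rintro ⟨h1, h2, h3⟩
      refine ⟨fun i => ?_, fun i j hij => ?_⟩
      · fin_cases i
        · exact h1
        · exact h2
      · fin_cases i <;> fin_cases j
        · exact absurd rfl hij
        · exact h3
        · exact hs.trans h3
        · exact absurd rfl hij
  have hbdd : Bornology.IsBounded {v : E | b v v < 1} :=
    (NormedSpace.isVonNBounded_iff ℝ).1 (g.isVonNBounded x)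
  obtain ⟨C, hC⟩ := hbdd.exists_norm_le
  have hnorm : ∀ v : E, b v v = 1 → ‖v‖ ≤ 2 * C := by
    intro v hv
    have h1 : ‖(1 / 2 : ℝ) • v‖ ≤ C := by
      apply hC
      have : b ((1 / 2 : ℝ) • v) ((1 / 2 : ℝ) • v) = 1 / 2 * (1 / 2 * b v v) := by simp
      rw [Set.mem_ofPred_eq, this, hv]
      norm_num
    rw [norm_smul] at h1
    norm_num at h1
    linarith
  have hcl : IsClosed K := by
    refine (isClosed_eq (by fun_prop) continuous_const).inter
      ((isClosed_eq (by fun_prop) continuous_const).inter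
        (isClosed_eq (by fun_prop) continuous_const))
  have : ProperSpace E := FiniteDimensional.proper_real E
  have hK : IsCompact K := by
    refine Metric.isCompact_of_isClosed_isBounded hcl
      ((Metric.isBounded_closedBall (x := (0 : E × E)) (r := 2 * C)).subset ?_)
    rintro ⟨u, v⟩ ⟨h1, h2, -⟩
    simpa [Prod.norm_def] using And.intro (hnorm u h1) (hnorm v h2)
  have hne : K.Nonempty := by
    obtain ⟨e, he1, he2⟩ := exists_isOrthonormal g x
    exact ⟨(e ⟨0, by omega⟩, e ⟨1, by omega⟩), he1 _, he1 _, he2 _ _ (by simp)⟩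
  let s : E × E → ℝ := fun p => b (curvature (metricInChart g x) (extChartAt 𝓘(ℝ, E) x x)
    p.1 p.2 p.2) p.1
  have hcont : Continuous s := by
    unfold s curvature
    fun_prop
  have himg : sectionalCurvatures g x = s '' K := by
    ext k
    constructor
    · rintro ⟨u, v, h, rfl⟩
      exact ⟨(u, v), (hort u v).1 h, rfl⟩
    · rintro ⟨⟨u, v⟩, h, rfl⟩
      exact ⟨u, v, (hort u v).2 h, rfl⟩
  rw [himg]
  exact ⟨(hK.image hcont).exists_isLeast (hne.image s),
    (hK.image hcont).exists_isGreatest (hne.image s)⟩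

/-- The invariant `δ^a`: `τ - a min k` for `0 ≤ a`, and `τ - a max k` for `a < 0`, where `k` is the
sectional curvature at `x`. The minimum and the maximum exist in dimension at least two, by
`exists_isLeast_isGreatest_sectionalCurvatures`. -/
def deltaInvariant [FiniteDimensional ℝ E] (a : ℝ) (g : SmoothMetric E M) (x : M) : ℝ :=
  if 0 ≤ a then scalarCurvature g x - a * sInf (sectionalCurvatures g x)
  else scalarCurvature g x - a * sSup (sectionalCurvatures g x)

end Manifolds

/-! ### Submanifolds -/

section Submanifolds

variable {E : Type*} [NormedAddCommGroup E] [NormedSpace ℝ E]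
  {M : Type*} [TopologicalSpace M] [ChartedSpace E M] [IsManifold 𝓘(ℝ, E) ∞ M]
  {F : Type*} [NormedAddCommGroup F] [NormedSpace ℝ F]
  {N : Type*} [TopologicalSpace N] [ChartedSpace F N] [IsManifold 𝓘(ℝ, F) ∞ N]

/-- `f` is a (smooth) isometric immersion, i.e. it makes `(M, g)` a Riemannian submanifold of
`(N, g')`. -/
structure IsIsometricImmersion (g : SmoothMetric E M) (g' : SmoothMetric F N) (f : M → N) :
    Prop where
  contMDiff : ContMDiff 𝓘(ℝ, E) 𝓘(ℝ, F) ∞ f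
  inner_eq : ∀ (x : M) (u v : TangentSpace 𝓘(ℝ, E) x),
    g'.inner (f x) (mfderiv 𝓘(ℝ, E) 𝓘(ℝ, F) f x u) (mfderiv 𝓘(ℝ, E) 𝓘(ℝ, F) f x v)
      = g.inner x u v

/-- The second fundamental form of `f` at `x`, by the Gauss formula
`h(u, v) = ∇'_u v - ∇_u v` (`∇'` and `∇` being the Levi-Civita connections of `N` and `M`).
With `φ` the expression of `f` in the preferred charts at `x` and `f x`, it is
`D²φ(u, v) + Γ'(Dφ u, Dφ v) - Dφ (Γ(u, v))`. -/
def secondFundamentalForm (g : SmoothMetric E M) (g' : SmoothMetric F N) (f : M → N) (x : M) :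
    TangentSpace 𝓘(ℝ, E) x →L[ℝ] TangentSpace 𝓘(ℝ, E) x →L[ℝ] TangentSpace 𝓘(ℝ, F) (f x) :=
  let φ : E → F := writtenInExtChartAt 𝓘(ℝ, E) 𝓘(ℝ, F) x f
  let y : E := extChartAt 𝓘(ℝ, E) x x
  let h : E →L[ℝ] E →L[ℝ] F :=
    fderiv ℝ (fderiv ℝ φ) y
      + (christoffel (metricInChart g' (f x)) (φ y)).bilinearComp (fderiv ℝ φ y) (fderiv ℝ φ y)
      - (ContinuousLinearMap.compL ℝ E E F (fderiv ℝ φ y)).comp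
          (christoffel (metricInChart g x) y)
  h

/-- The mean curvature vector `H = (1/n) ∑ h(e_i, e_i)` at `x`. -/
def meanCurvatureVector [FiniteDimensional ℝ E] (g : SmoothMetric E M) (g' : SmoothMetric F N)
    (f : M → N) (x : M) : TangentSpace 𝓘(ℝ, F) (f x) :=
  (1 / (Module.finrank ℝ E : ℝ)) • ∑ i,
    secondFundamentalForm g g' f x (orthonormalFrame g x i) (orthonormalFrame g x i)

variable (E) in
/-- `ξ` is normal to the submanifold at `x`. -/
def IsNormal (g' : SmoothMetric F N) (f : M → N) (x : M) (ξ : TangentSpace 𝓘(ℝ, F) (f x)) : Prop :=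
  ∀ u : TangentSpace 𝓘(ℝ, E) x, g'.inner (f x) (mfderiv 𝓘(ℝ, E) 𝓘(ℝ, F) f x u) ξ = 0

/-- The Weingarten operator `A_ξ`, defined by `g (A_ξ u, v) = g' (h (u, v), ξ)`: the bilinear form
on the right-hand side is composed with the inverse of `u ↦ g (u, ·)`. -/
def weingarten (g : SmoothMetric E M) (g' : SmoothMetric F N) (f : M → N) (x : M)
    (ξ : TangentSpace 𝓘(ℝ, F) (f x)) :
    TangentSpace 𝓘(ℝ, E) x →L[ℝ] TangentSpace 𝓘(ℝ, E) x :=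
  (g.inner x).inverse.comp
    ((ContinuousLinearMap.compL ℝ E F ℝ (g'.inner (f x) ξ)).comp (secondFundamentalForm g g' f x))

/-- The matrix `(h_ij)` of the Weingarten operator `A_ξ` in the orthonormal frame `e`. -/
def weingartenMatrix {ι : Type*} (g : SmoothMetric E M) (g' : SmoothMetric F N) (f : M → N) (x : M)
    (e : ι → TangentSpace 𝓘(ℝ, E) x) (ξ : TangentSpace 𝓘(ℝ, F) (f x)) : Matrix ι ι ℝ :=
  Matrix.of fun i j => g.inner x (weingarten g g' f x ξ (e j)) (e i)

end Submanifolds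

end

section Coordinates

variable {E : Type*} [NormedAddCommGroup E] [NormedSpace ℝ E]

theorem apply_christoffel {G : E → E →L[ℝ] E →L[ℝ] ℝ} {y : E} (hG : (G y).IsInvertible)
    (u v w : E) : G y (christoffel G y u v) w = christoffelFirst (fderiv ℝ G y) u v w := by
  simp [christoffel, hG.self_apply_inverse]

theorem christoffelFirst_symm (D : E →L[ℝ] E →L[ℝ] E →L[ℝ] ℝ) (hD : ∀ u v w, D u v w = D u w v)
    (u v w : E) : christoffelFirst D u v w = christoffelFirst D v u w := by
  simp only [christoffelFirst_apply, hD w u v]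
  ring

theorem fderiv_apply_symm {G : E → E →L[ℝ] E →L[ℝ] ℝ} {y : E} (hd : DifferentiableAt ℝ G y)
    (hs : ∀ z v w, G z v w = G z w v) (u v w : E) :
    fderiv ℝ G y u v w = fderiv ℝ G y u w v := by
  have h1 : ∀ v w, HasFDerivAt (fun z => G z v w)
      ((ContinuousLinearMap.apply ℝ ℝ w).comp
        ((ContinuousLinearMap.apply ℝ (E →L[ℝ] ℝ) v).comp (fderiv ℝ G y))) y := fun v w =>
    (ContinuousLinearMap.apply ℝ ℝ w).hasFDerivAt.comp y
      ((ContinuousLinearMap.apply ℝ (E →L[ℝ] ℝ) v).hasFDerivAt.comp y hd.hasFDerivAt)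
  have h2 := (h1 v w).unique ((h1 w v).congr_of_eventuallyEq
    (Filter.Eventually.of_forall fun z => hs z v w))
  simpa using congrArg (fun L => L u) h2

theorem christoffel_symm {G : E → E →L[ℝ] E →L[ℝ] ℝ} {y : E} (hd : DifferentiableAt ℝ G y)
    (hs : ∀ z v w, G z v w = G z w v) (u v : E) :
    christoffel G y u v = christoffel G y v u := by
  have : christoffelFirst (fderiv ℝ G y) u v = christoffelFirst (fderiv ℝ G y) v u := by
    ext w
    exact christoffelFirst_symm _ (fderiv_apply_symm hd hs) u v w
  simp [christoffel, this]

theorem differentiableAt_christoffelFirst {G : E → E →L[ℝ] E →L[ℝ] ℝ} {y : E}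
    (hG : ContDiffAt ℝ 2 G y) :
    DifferentiableAt ℝ (fun z => christoffelFirst (fderiv ℝ G z)) y := by
  have h : DifferentiableAt ℝ (fderiv ℝ G) y :=
    (hG.fderiv_right (m := 1) (by norm_num)).differentiableAt (by norm_num)
  have h2 : DifferentiableAt ℝ (fun z => (fderiv ℝ G z).flip) y :=
    (ContinuousLinearMap.flipₗᵢ ℝ E E (E →L[ℝ] ℝ)).toContinuousLinearEquiv.differentiableAt.comp y h
  let T : (E →L[ℝ] E →L[ℝ] ℝ) →L[ℝ] E →L[ℝ] E →L[ℝ] ℝ := ContinuousLinearMap.flipₗᵢ ℝ E E ℝ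
  have h3 : DifferentiableAt ℝ (fun z => T.comp (fderiv ℝ G z).flip) y :=
    (ContinuousLinearMap.compL ℝ E (E →L[ℝ] E →L[ℝ] ℝ) (E →L[ℝ] E →L[ℝ] ℝ)
      T).differentiableAt.comp y h2
  have h4 : DifferentiableAt ℝ (fun z =>
      fderiv ℝ G z + (fderiv ℝ G z).flip - T.comp (fderiv ℝ G z).flip) y := (h.add h2).sub h3
  exact h4.const_smul (1 / 2 : ℝ)

theorem hasFDerivAt_christoffelFirst_apply {G : E → E →L[ℝ] E →L[ℝ] ℝ} {y : E}
    (hG : ContDiffAt ℝ 2 G y) (v w t : E) :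
    ∃ L : E →L[ℝ] ℝ, HasFDerivAt (fun z => christoffelFirst (fderiv ℝ G z) v w t) L y ∧
      ∀ u, L u = christoffelFirst (fderiv ℝ (fderiv ℝ G) y u) v w t := by
  have h : DifferentiableAt ℝ (fderiv ℝ G) y :=
    (hG.fderiv_right (m := 1) (by norm_num)).differentiableAt (by norm_num)
  have h1 : ∀ v w t, HasFDerivAt (fun z => fderiv ℝ G z v w t)
      ((ContinuousLinearMap.apply ℝ ℝ t).comp ((ContinuousLinearMap.apply ℝ (E →L[ℝ] ℝ) w).comp
        ((ContinuousLinearMap.apply ℝ (E →L[ℝ] E →L[ℝ] ℝ) v).comp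
          (fderiv ℝ (fderiv ℝ G) y)))) y := fun v w t =>
    (ContinuousLinearMap.apply ℝ ℝ t).hasFDerivAt.comp y
      ((ContinuousLinearMap.apply ℝ (E →L[ℝ] ℝ) w).hasFDerivAt.comp y
        ((ContinuousLinearMap.apply ℝ (E →L[ℝ] E →L[ℝ] ℝ) v).hasFDerivAt.comp y h.hasFDerivAt))
  refine ⟨_, (((h1 v w t).add (h1 w v t)).sub (h1 t v w)).const_mul (1 / 2) |>.congr_of_eventuallyEq
    (Filter.Eventually.of_forall fun z => ?_), fun u => ?_⟩
  · simp [christoffelFirst_apply]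
  · simp [christoffelFirst_apply]

theorem fderiv_christoffelFirst {G : E → E →L[ℝ] E →L[ℝ] ℝ} {y : E}
    (hG : ContDiffAt ℝ 2 G y) (u : E) :
    fderiv ℝ (fun z => christoffelFirst (fderiv ℝ G z)) y u
      = christoffelFirst (fderiv ℝ (fderiv ℝ G) y u) := by
  ext v w t
  obtain ⟨L, hL, hLu⟩ := hasFDerivAt_christoffelFirst_apply hG v w t
  have h := ((ContinuousLinearMap.apply ℝ ℝ t).hasFDerivAt.comp y
    ((ContinuousLinearMap.apply ℝ (E →L[ℝ] ℝ) w).hasFDerivAt.comp y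
      ((ContinuousLinearMap.apply ℝ (E →L[ℝ] E →L[ℝ] ℝ) v).hasFDerivAt.comp y
        (differentiableAt_christoffelFirst hG).hasFDerivAt))).unique hL
  rw [← hLu]
  exact congrArg (fun L => L u) h

theorem differentiableAt_christoffel [CompleteSpace E] {G : E → E →L[ℝ] E →L[ℝ] ℝ} {y : E}
    (hG : ContDiffAt ℝ 2 G y) (hi : (G y).IsInvertible) :
    DifferentiableAt ℝ (christoffel G) y := by
  have h1 : DifferentiableAt ℝ (fun z => (G z).inverse) y :=
    (hi.contDiffAt_map_inverse (n := 2)).differentiableAt (by norm_num) |>.comp y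
      (hG.differentiableAt (by norm_num))
  have h2 := differentiableAt_christoffelFirst hG
  unfold christoffel
  exact ((ContinuousLinearMap.compL ℝ E (E →L[ℝ] ℝ) E).differentiableAt.comp y h1).clm_comp h2

theorem eventually_isInvertible [CompleteSpace E] {G : E → E →L[ℝ] E →L[ℝ] ℝ} {y : E}
    (hG : ContinuousAt G y) (hi : (G y).IsInvertible) : ∀ᶠ z in nhds y, (G z).IsInvertible := by
  obtain ⟨e, he⟩ := hi
  have := hG.eventually (by rw [← he]; exact ContinuousLinearEquiv.nhds e)
  filter_upwards [this] with z hz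
  obtain ⟨e', he'⟩ := hz
  exact ⟨e', he'⟩

/-- The curvature tensor of a metric with its last index lowered. -/
theorem apply_curvature [CompleteSpace E] {G : E → E →L[ℝ] E →L[ℝ] ℝ} {y : E}
    (hG : ContDiffAt ℝ 2 G y) (hi : (G y).IsInvertible) (hs : ∀ z v w, G z v w = G z w v)
    (u v w t : E) :
    G y (curvature G y u v w) t
      = christoffelFirst (fderiv ℝ (fderiv ℝ G) y u) v w t
        - christoffelFirst (fderiv ℝ (fderiv ℝ G) y v) u w t
        - G y (christoffel G y v w) (christoffel G y u t)
        + G y (christoffel G y u w) (christoffel G y v t) := by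
  have hd : DifferentiableAt ℝ G y := hG.differentiableAt (by norm_num)
  have key : ∀ u v w, G y (fderiv ℝ (christoffel G) y u v w) t
      = christoffelFirst (fderiv ℝ (fderiv ℝ G) y u) v w t
        - fderiv ℝ G y u (christoffel G y v w) t := by
    intro u v w
    obtain ⟨L, hL, hLu⟩ := hasFDerivAt_christoffelFirst_apply hG v w t
    have hΓ := (differentiableAt_christoffel hG hi).hasFDerivAt
    have h1 : HasFDerivAt (fun z => christoffel G z v w)
        ((ContinuousLinearMap.apply ℝ E w).comp
          ((ContinuousLinearMap.apply ℝ (E →L[ℝ] E) v).comp (fderiv ℝ (christoffel G) y))) y :=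
      (ContinuousLinearMap.apply ℝ E w).hasFDerivAt.comp y
        ((ContinuousLinearMap.apply ℝ (E →L[ℝ] E) v).hasFDerivAt.comp y hΓ)
    have h2 := (ContinuousLinearMap.apply ℝ ℝ t).hasFDerivAt.comp y (hd.hasFDerivAt.clm_apply h1)
    have h3 := h2.unique (hL.congr_of_eventuallyEq
      ((eventually_isInvertible hd.continuousAt hi).mono fun z hz => by
        simpa using apply_christoffel hz v w t))
    have h4 := congrArg (fun L => L u) h3
    simp only [hLu] at h4
    rw [← h4]
    simp
  have h5 : ∀ u p, fderiv ℝ G y u p t = christoffelFirst (fderiv ℝ G y) u p t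
      + christoffelFirst (fderiv ℝ G y) u t p := by
    intro u p
    simp only [christoffelFirst_apply, fderiv_apply_symm hd hs u t p]
    ring
  simp only [curvature, map_add, map_sub, add_apply, sub_apply, key, h5, ← apply_christoffel hi]
  rw [hs y (christoffel G y u t), hs y (christoffel G y v t)]
  ring

variable {F : Type*} [NormedAddCommGroup F] [NormedSpace ℝ F]

theorem hasFDerivAt_fderiv_apply {φ : E → F} {y : E} (hφ : ContDiffAt ℝ 2 φ y) (u : E) :
    HasFDerivAt (fun z => fderiv ℝ φ z u) (fderiv ℝ (fderiv ℝ φ) y u) y := by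
  have h := ((hφ.fderiv_right (m := 1) (by norm_num)).differentiableAt (by norm_num)).hasFDerivAt
  have h1 := (ContinuousLinearMap.apply ℝ F u).hasFDerivAt.comp y h
  refine h1.congr_fderiv ?_
  ext v
  have := (hφ.isSymmSndFDerivAt (by simp)).eq v u
  simpa using this

theorem hasFDerivAt_fderiv_fderiv_apply {φ : E → F} {y : E} (hφ : ContDiffAt ℝ 3 φ y) (u v : E) :
    HasFDerivAt (fun z => fderiv ℝ (fderiv ℝ φ) z u v)
      ((ContinuousLinearMap.apply ℝ F v).comp ((ContinuousLinearMap.apply ℝ (E →L[ℝ] F) u).comp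
        (fderiv ℝ (fderiv ℝ (fderiv ℝ φ)) y))) y := by
  have h := (((hφ.fderiv_right (m := 2) (by norm_num)).fderiv_right (m := 1)
    (by norm_num)).differentiableAt (by norm_num)).hasFDerivAt
  exact (ContinuousLinearMap.apply ℝ F v).hasFDerivAt.comp y
    ((ContinuousLinearMap.apply ℝ (E →L[ℝ] F) u).hasFDerivAt.comp y h)

/-- The third derivative is symmetric in the first two arguments. -/
theorem fderiv_fderiv_fderiv_comm {φ : E → F} {y : E} (hφ : ContDiffAt ℝ 3 φ y) (u v w : E) :
    fderiv ℝ (fderiv ℝ (fderiv ℝ φ)) y u v w = fderiv ℝ (fderiv ℝ (fderiv ℝ φ)) y v u w := by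
  have h := ((hφ.fderiv_right (m := 2) (by norm_num)).isSymmSndFDerivAt (by simp)).eq u v
  exact congrArg (fun L => L w) h

/-- The derivative of `z ↦ G (φ z) (X z) (Y z)`. -/
theorem hasFDerivAt_bilin_comp {G : F → F →L[ℝ] F →L[ℝ] ℝ} {φ X Y : E → F} {y : E}
    {φ' X' Y' : E →L[ℝ] F} (hG : DifferentiableAt ℝ G (φ y)) (hφ : HasFDerivAt φ φ' y)
    (hX : HasFDerivAt X X' y) (hY : HasFDerivAt Y Y' y) :
    ∃ L : E →L[ℝ] ℝ, HasFDerivAt (fun z => G (φ z) (X z) (Y z)) L y ∧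
      ∀ u, L u = fderiv ℝ G (φ y) (φ' u) (X y) (Y y) + G (φ y) (X' u) (Y y)
        + G (φ y) (X y) (Y' u) := by
  have h1 : HasFDerivAt (fun z => G (φ z)) ((fderiv ℝ G (φ y)).comp φ') y :=
    hG.hasFDerivAt.comp y hφ
  refine ⟨_, (h1.clm_apply hX).clm_apply hY, fun u => ?_⟩
  simp
  ring

theorem hasFDerivAt_christoffelFirst_comp {G : F → F →L[ℝ] F →L[ℝ] ℝ} {φ X Y Z : E → F} {y : E}
    {φ' X' Y' Z' : E →L[ℝ] F} (hG : ContDiffAt ℝ 2 G (φ y)) (hφ : HasFDerivAt φ φ' y)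
    (hX : HasFDerivAt X X' y) (hY : HasFDerivAt Y Y' y) (hZ : HasFDerivAt Z Z' y) :
    ∃ L : E →L[ℝ] ℝ,
      HasFDerivAt (fun z => christoffelFirst (fderiv ℝ G (φ z)) (X z) (Y z) (Z z)) L y ∧
      ∀ u, L u = christoffelFirst (fderiv ℝ (fderiv ℝ G) (φ y) (φ' u)) (X y) (Y y) (Z y)
        + christoffelFirst (fderiv ℝ G (φ y)) (X' u) (Y y) (Z y)
        + christoffelFirst (fderiv ℝ G (φ y)) (X y) (Y' u) (Z y)
        + christoffelFirst (fderiv ℝ G (φ y)) (X y) (Y y) (Z' u) := by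
  have h1 : HasFDerivAt (fun z => christoffelFirst (fderiv ℝ G (φ z)))
      ((fderiv ℝ (fun z => christoffelFirst (fderiv ℝ G z)) (φ y)).comp φ') y :=
    (differentiableAt_christoffelFirst hG).hasFDerivAt.comp y hφ
  refine ⟨_, ((h1.clm_apply hX).clm_apply hY).clm_apply hZ, fun u => ?_⟩
  simp [fderiv_christoffelFirst hG]
  ring

section Pullback

variable {G : E → E →L[ℝ] E →L[ℝ] ℝ} {G' : F → F →L[ℝ] F →L[ℝ] ℝ} {φ : E → F} {y : E}

theorem christoffelFirst_pullback (hG : DifferentiableAt ℝ G y)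
    (hG' : DifferentiableAt ℝ G' (φ y)) (hs' : ∀ z v w, G' z v w = G' z w v)
    (hφ : ContDiffAt ℝ 2 φ y)
    (hp : ∀ᶠ z in nhds y, ∀ u v, G z u v = G' (φ z) (fderiv ℝ φ z u) (fderiv ℝ φ z v))
    (u v w : E) :
    christoffelFirst (fderiv ℝ G y) u v w
      = christoffelFirst (fderiv ℝ G' (φ y)) (fderiv ℝ φ y u) (fderiv ℝ φ y v) (fderiv ℝ φ y w)
        + G' (φ y) (fderiv ℝ (fderiv ℝ φ) y u v) (fderiv ℝ φ y w) := by
  have hd : HasFDerivAt φ (fderiv ℝ φ y) y := (hφ.differentiableAt (by norm_num)).hasFDerivAt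
  have hsymm : ∀ u v, fderiv ℝ (fderiv ℝ φ) y u v = fderiv ℝ (fderiv ℝ φ) y v u :=
    (hφ.isSymmSndFDerivAt (by simp)).eq
  have key : ∀ u v w, fderiv ℝ G y u v w
      = fderiv ℝ G' (φ y) (fderiv ℝ φ y u) (fderiv ℝ φ y v) (fderiv ℝ φ y w)
        + G' (φ y) (fderiv ℝ (fderiv ℝ φ) y v u) (fderiv ℝ φ y w)
        + G' (φ y) (fderiv ℝ φ y v) (fderiv ℝ (fderiv ℝ φ) y w u) := by
    intro u v w
    obtain ⟨L, hL, hLu⟩ := hasFDerivAt_bilin_comp hG' hd (hasFDerivAt_fderiv_apply hφ v)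
      (hasFDerivAt_fderiv_apply hφ w)
    have h1 := (ContinuousLinearMap.apply ℝ ℝ w).hasFDerivAt.comp y
      ((ContinuousLinearMap.apply ℝ (E →L[ℝ] ℝ) v).hasFDerivAt.comp y hG.hasFDerivAt)
    rw [← hLu, hL.unique (h1.congr_of_eventuallyEq (hp.mono fun z hz => (hz v w).symm))]
    rfl
  simp only [christoffelFirst_apply, key, hsymm w v, hsymm w u, hsymm v u,
    hs' _ (fderiv ℝ φ y u) (fderiv ℝ (fderiv ℝ φ) y v w),
    hs' _ (fderiv ℝ φ y v) (fderiv ℝ (fderiv ℝ φ) y u w)]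
  ring

theorem christoffelFirst_fderiv_pullback (hG : ContDiffAt ℝ 2 G y)
    (hG' : ContDiffAt ℝ 2 G' (φ y)) (hs' : ∀ z v w, G' z v w = G' z w v)
    (hφ : ContDiffAt ℝ 3 φ y)
    (hp : ∀ᶠ z in nhds y, ∀ u v, G z u v = G' (φ z) (fderiv ℝ φ z u) (fderiv ℝ φ z v))
    (s u v w : E) :
    christoffelFirst (fderiv ℝ (fderiv ℝ G) y s) u v w
      = christoffelFirst (fderiv ℝ (fderiv ℝ G') (φ y) (fderiv ℝ φ y s))
          (fderiv ℝ φ y u) (fderiv ℝ φ y v) (fderiv ℝ φ y w)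
        + christoffelFirst (fderiv ℝ G' (φ y))
          (fderiv ℝ (fderiv ℝ φ) y u s) (fderiv ℝ φ y v) (fderiv ℝ φ y w)
        + christoffelFirst (fderiv ℝ G' (φ y))
          (fderiv ℝ φ y u) (fderiv ℝ (fderiv ℝ φ) y v s) (fderiv ℝ φ y w)
        + christoffelFirst (fderiv ℝ G' (φ y))
          (fderiv ℝ φ y u) (fderiv ℝ φ y v) (fderiv ℝ (fderiv ℝ φ) y w s)
        + (fderiv ℝ G' (φ y) (fderiv ℝ φ y s) (fderiv ℝ (fderiv ℝ φ) y u v) (fderiv ℝ φ y w)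
          + G' (φ y) (fderiv ℝ (fderiv ℝ (fderiv ℝ φ)) y s u v) (fderiv ℝ φ y w)
          + G' (φ y) (fderiv ℝ (fderiv ℝ φ) y u v) (fderiv ℝ (fderiv ℝ φ) y w s)) := by
  have hφ2 : ContDiffAt ℝ 2 φ y := hφ.of_le (by norm_num)
  have hd : HasFDerivAt φ (fderiv ℝ φ y) y := (hφ.differentiableAt (by norm_num)).hasFDerivAt
  have hev : ∀ᶠ z in nhds y, christoffelFirst (fderiv ℝ G z) u v w
      = christoffelFirst (fderiv ℝ G' (φ z)) (fderiv ℝ φ z u) (fderiv ℝ φ z v) (fderiv ℝ φ z w)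
        + G' (φ z) (fderiv ℝ (fderiv ℝ φ) z u v) (fderiv ℝ φ z w) := by
    filter_upwards [hG.eventually (by simp), hd.continuousAt.eventually (hG'.eventually (by simp)),
      hφ2.eventually (by simp), hp.eventually_nhds] with z h1 h2 h3 h4
    exact christoffelFirst_pullback (h1.differentiableAt (by norm_num))
      (h2.differentiableAt (by norm_num)) hs' h3 h4 u v w
  obtain ⟨L, hL, hLu⟩ := hasFDerivAt_christoffelFirst_apply hG u v w
  obtain ⟨L₁, hL₁, hLu₁⟩ := hasFDerivAt_christoffelFirst_comp hG' hd
    (hasFDerivAt_fderiv_apply hφ2 u) (hasFDerivAt_fderiv_apply hφ2 v)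
    (hasFDerivAt_fderiv_apply hφ2 w)
  obtain ⟨L₂, hL₂, hLu₂⟩ := hasFDerivAt_bilin_comp (hG'.differentiableAt (by norm_num)) hd
    (hasFDerivAt_fderiv_fderiv_apply hφ u v) (hasFDerivAt_fderiv_apply hφ2 w)
  rw [← hLu, hL.unique ((hL₁.add hL₂).congr_of_eventuallyEq hev), add_apply, hLu₁, hLu₂]
  rfl

/-- The second fundamental form is normal. -/
theorem pullback_normal (hG : DifferentiableAt ℝ G y) (hi : (G y).IsInvertible)
    (hG' : DifferentiableAt ℝ G' (φ y)) (hi' : (G' (φ y)).IsInvertible)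
    (hs' : ∀ z v w, G' z v w = G' z w v) (hφ : ContDiffAt ℝ 2 φ y)
    (hp : ∀ᶠ z in nhds y, ∀ u v, G z u v = G' (φ z) (fderiv ℝ φ z u) (fderiv ℝ φ z v))
    (u v w : E) :
    G' (φ y) (fderiv ℝ (fderiv ℝ φ) y u v
      + christoffel G' (φ y) (fderiv ℝ φ y u) (fderiv ℝ φ y v)
      - fderiv ℝ φ y (christoffel G y u v)) (fderiv ℝ φ y w) = 0 := by
  have h := christoffelFirst_pullback hG hG' hs' hφ hp u v w
  rw [← apply_christoffel hi, ← apply_christoffel hi', hp.self_of_nhds] at h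
  simp only [map_add, map_sub, add_apply, sub_apply, h]
  ring

/-- The Gauss equation in coordinates. -/
theorem gauss_equation_coordinates [CompleteSpace E] [CompleteSpace F]
    (hG : ContDiffAt ℝ 2 G y) (hi : (G y).IsInvertible) (hs : ∀ z v w, G z v w = G z w v)
    (hG' : ContDiffAt ℝ 2 G' (φ y)) (hi' : (G' (φ y)).IsInvertible)
    (hs' : ∀ z v w, G' z v w = G' z w v) (hφ : ContDiffAt ℝ 3 φ y)
    (hp : ∀ᶠ z in nhds y, ∀ u v, G z u v = G' (φ z) (fderiv ℝ φ z u) (fderiv ℝ φ z v))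
    {h : E → E → F} (hh : ∀ u v, h u v = fderiv ℝ (fderiv ℝ φ) y u v
      + christoffel G' (φ y) (fderiv ℝ φ y u) (fderiv ℝ φ y v)
      - fderiv ℝ φ y (christoffel G y u v)) (u v : E) :
    G y (curvature G y u v v) u
      = G' (φ y) (curvature G' (φ y) (fderiv ℝ φ y u) (fderiv ℝ φ y v) (fderiv ℝ φ y v))
          (fderiv ℝ φ y u)
        + G' (φ y) (h u u) (h v v) - G' (φ y) (h u v) (h u v) := by
  have hφ2 : ContDiffAt ℝ 2 φ y := hφ.of_le (by norm_num)
  have hd := hG.differentiableAt (by norm_num)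
  have hd' := hG'.differentiableAt (by norm_num)
  have hn : ∀ u v w, G' (φ y) (h u v) (fderiv ℝ φ y w) = 0 := fun u v w => by
    rw [hh]; exact pullback_normal hd hi hd' hi' hs' hφ2 hp u v w
  have hsymm : fderiv ℝ (fderiv ℝ φ) y v u = fderiv ℝ (fderiv ℝ φ) y u v :=
    (hφ2.isSymmSndFDerivAt (by simp)).eq v u
  have hΓ := christoffel_symm hd hs v u
  have hΓ' := christoffel_symm hd' hs' (fderiv ℝ φ y v) (fderiv ℝ φ y u)
  have h5 : ∀ u p t, fderiv ℝ G' (φ y) u p t = christoffelFirst (fderiv ℝ G' (φ y)) u p t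
      + christoffelFirst (fderiv ℝ G' (φ y)) u t p := by
    intro u p t
    simp only [christoffelFirst_apply, fderiv_apply_symm hd' hs' u t p]
    ring
  have hhh : ∀ u v w t, G' (φ y) (h u v) (h w t)
      = G' (φ y) (fderiv ℝ (fderiv ℝ φ) y u v) (fderiv ℝ (fderiv ℝ φ) y w t)
        + christoffelFirst (fderiv ℝ G' (φ y)) (fderiv ℝ φ y u) (fderiv ℝ φ y v)
          (fderiv ℝ (fderiv ℝ φ) y w t)
        + christoffelFirst (fderiv ℝ G' (φ y)) (fderiv ℝ φ y w) (fderiv ℝ φ y t)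
          (fderiv ℝ (fderiv ℝ φ) y u v)
        + G' (φ y) (christoffel G' (φ y) (fderiv ℝ φ y u) (fderiv ℝ φ y v))
          (christoffel G' (φ y) (fderiv ℝ φ y w) (fderiv ℝ φ y t))
        - G y (christoffel G y u v) (christoffel G y w t) := by
    intro u v w t
    have h1 := hn u v (christoffel G y w t)
    have h2 := hn w t (christoffel G y u v)
    rw [hs'] at h2
    rw [hh] at h1 h2
    rw [hh, hh, ← apply_christoffel hi', ← apply_christoffel hi', hp.self_of_nhds,
      hs' _ (christoffel G' (φ y) (fderiv ℝ φ y w) (fderiv ℝ φ y t))]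
    simp only [map_add, map_sub, add_apply, sub_apply] at h1 h2 ⊢
    linear_combination - h1 - h2
  rw [apply_curvature hG hi hs, apply_curvature hG' hi' hs',
    christoffelFirst_fderiv_pullback hG hG' hs' hφ hp,
    christoffelFirst_fderiv_pullback hG hG' hs' hφ hp, fderiv_fderiv_fderiv_comm hφ u v v,
    hhh, hhh, hsymm, hΓ, hΓ', h5, h5,
    christoffelFirst_symm _ (fderiv_apply_symm hd' hs') (fderiv ℝ φ y v) (fderiv ℝ φ y u)
      (fderiv ℝ (fderiv ℝ φ) y u v),
    hs y (christoffel G y v v), hs' _ (fderiv ℝ (fderiv ℝ φ) y v v),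
    hs' _ (christoffel G' (φ y) (fderiv ℝ φ y v) (fderiv ℝ φ y v))]
  ring

end Pullback

end Coordinates

section Charts

theorem two_le_infty : (2 : WithTop ℕ∞) ≤ ∞ := WithTop.coe_le_coe.2 (le_top : (2 : ℕ∞) ≤ ⊤)

theorem three_le_infty : (3 : WithTop ℕ∞) ≤ ∞ := WithTop.coe_le_coe.2 (le_top : (3 : ℕ∞) ≤ ⊤)

open Bundle

variable {E : Type*} [NormedAddCommGroup E] [NormedSpace ℝ E]
  {M : Type*} [TopologicalSpace M] [ChartedSpace E M] [IsManifold 𝓘(ℝ, E) ∞ M]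

theorem contMDiffOn_mfderiv_extChartAt_symm (x : M) (u : E) :
    ContMDiffOn 𝓘(ℝ, E) (𝓘(ℝ, E).prod 𝓘(ℝ, E)) ∞
      (fun y : E => (TotalSpace.mk' E ((extChartAt 𝓘(ℝ, E) x).symm y)
        (show TangentSpace 𝓘(ℝ, E) ((extChartAt 𝓘(ℝ, E) x).symm y) from
          mfderiv 𝓘(ℝ, E) 𝓘(ℝ, E) (extChartAt 𝓘(ℝ, E) x).symm y u) : TangentBundle 𝓘(ℝ, E) M))
      (extChartAt 𝓘(ℝ, E) x).target := by
  set e := trivializationAt E (TangentSpace 𝓘(ℝ, E)) x with he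
  have h1 : ContMDiffOn 𝓘(ℝ, E) (𝓘(ℝ, E).prod 𝓘(ℝ, E)) ∞
      (fun y : E => ((extChartAt 𝓘(ℝ, E) x).symm y, u)) (extChartAt 𝓘(ℝ, E) x).target :=
    (contMDiffOn_extChartAt_symm x).prodMk contMDiffOn_const
  have hsrc : ∀ y ∈ (extChartAt 𝓘(ℝ, E) x).target,
      (extChartAt 𝓘(ℝ, E) x).symm y ∈ (chartAt E x).source := fun y hy => by
    have := (extChartAt 𝓘(ℝ, E) x).map_target hy
    rwa [extChartAt_source] at this
  have hbase : ∀ y ∈ (extChartAt 𝓘(ℝ, E) x).target,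
      (extChartAt 𝓘(ℝ, E) x).symm y ∈ e.baseSet := hsrc
  refine (e.contMDiffOn_symm.comp h1 fun y hy => ?_).congr fun y hy => ?_
  · rw [Set.mem_preimage, e.mem_target]
    exact hbase y hy
  · have h2 := TangentBundle.symmL_trivializationAt (𝕜 := ℝ) (I := 𝓘(ℝ, E)) (hsrc y hy)
    rw [(extChartAt 𝓘(ℝ, E) x).right_inv hy, ModelWithCorners.range_eq_univ,
      mfderivWithin_univ] at h2
    simp only [Function.comp_def]
    rw [← e.mk_symm (hbase y hy)]
    congr 1
    exact (congrArg (fun L => L u) h2).symm.trans (e.symmL_apply (R := ℝ) (hbase y hy) u)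

theorem contDiffOn_metricInChart [FiniteDimensional ℝ E] (g : SmoothMetric E M) (x : M) :
    ContDiffOn ℝ ∞ (metricInChart g x) (extChartAt 𝓘(ℝ, E) x).target := by
  rw [contDiffOn_clm_apply]
  intro u
  rw [contDiffOn_clm_apply]
  intro v
  have h1 : ContMDiffOn 𝓘(ℝ, E) (𝓘(ℝ, E).prod 𝓘(ℝ, E →L[ℝ] E →L[ℝ] ℝ)) ∞
      (fun y : E => TotalSpace.mk' (E →L[ℝ] E →L[ℝ] ℝ)
        (E := fun (x : M) ↦ (TangentSpace 𝓘(ℝ, E) x →L[ℝ] TangentSpace 𝓘(ℝ, E) x →L[ℝ] ℝ))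
        ((extChartAt 𝓘(ℝ, E) x).symm y) (g.inner ((extChartAt 𝓘(ℝ, E) x).symm y)))
      (extChartAt 𝓘(ℝ, E) x).target :=
    g.contMDiff.comp_contMDiffOn (contMDiffOn_extChartAt_symm x)
  have h2 := ContMDiffOn.clm_bundle_apply₂ (F₁ := E) (F₂ := E) (F₃ := ℝ)
    (E₁ := fun x : M => TangentSpace 𝓘(ℝ, E) x) (E₂ := fun x : M => TangentSpace 𝓘(ℝ, E) x)
    (E₃ := Bundle.Trivial M ℝ)
    h1 (contMDiffOn_mfderiv_extChartAt_symm x u) (contMDiffOn_mfderiv_extChartAt_symm x v)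
  have h3 : ContMDiffOn 𝓘(ℝ, E) 𝓘(ℝ, ℝ) ∞ (fun y => metricInChart g x y u v)
      (extChartAt 𝓘(ℝ, E) x).target := fun y hy => by
    have := h2 y hy
    simp only [contMDiffWithinAt_totalSpace] at this
    exact this.2
  exact h3.contDiffOn

theorem contDiffAt_metricInChart [FiniteDimensional ℝ E] (g : SmoothMetric E M) (x : M) :
    ContDiffAt ℝ ∞ (metricInChart g x) (extChartAt 𝓘(ℝ, E) x x) :=
  (contDiffOn_metricInChart g x).contDiffAt
    ((isOpen_extChartAt_target x).mem_nhds (mem_extChartAt_target x))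

theorem metricInChart_symm (g : SmoothMetric E M) (x : M) (y u v : E) :
    metricInChart g x y u v = metricInChart g x y v u := by
  simp only [metricInChart]
  exact g.symm _ _ _

/-- The metric at `x` as a bilinear form on the model space. -/
def metricBilin (g : SmoothMetric E M) (x : M) : E →L[ℝ] E →L[ℝ] ℝ := g.inner x

theorem metricInChart_self (g : SmoothMetric E M) (x : M) :
    metricInChart g x (extChartAt 𝓘(ℝ, E) x x) = metricBilin g x := by
  have h1 := mfderivWithin_range_extChartAt_symm (𝕜 := ℝ) (I := 𝓘(ℝ, E)) (x := x)
  rw [ModelWithCorners.range_eq_univ, mfderivWithin_univ] at h1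
  have h2 : ∀ p : M, p = x → ∀ d : E →L[ℝ] E, d = ContinuousLinearMap.id ℝ E → ∀ u v,
      metricBilin g p (d u) (d v) = metricBilin g x u v := by
    rintro p rfl d rfl u v
    rfl
  ext u v
  exact h2 _ (extChartAt_to_inv x) _ h1 u v

theorem metricBilin_symm (g : SmoothMetric E M) (x : M) (u v : E) :
    metricBilin g x u v = metricBilin g x v u :=
  g.symm x u v

theorem metricBilin_pos (g : SmoothMetric E M) (x : M) (u : E) (hu : u ≠ 0) :
    0 < metricBilin g x u u :=
  g.pos x u hu

theorem isInvertible_metricInChart [FiniteDimensional ℝ E] (g : SmoothMetric E M) (x : M) :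
    (metricInChart g x (extChartAt 𝓘(ℝ, E) x x)).IsInvertible := by
  set B := metricInChart g x (extChartAt 𝓘(ℝ, E) x x) with hB
  have hinj : Function.Injective B := by
    rw [injective_iff_map_eq_zero]
    intro u hu
    by_contra h0
    have h1 := metricBilin_pos g x u h0
    rw [← metricInChart_self, ← hB, hu] at h1
    simp at h1
  let L : (E →L[ℝ] ℝ) ≃ₗ[ℝ] (E →ₗ[ℝ] ℝ) := LinearMap.toContinuousLinearMap.symm
  have hfr : Module.finrank ℝ E = Module.finrank ℝ (E →L[ℝ] ℝ) := by
    rw [L.finrank_eq]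
    exact (Subspace.dual_finrank_eq (K := ℝ) (V := E)).symm
  exact ⟨(LinearEquiv.ofInjectiveOfFinrankEq B.toLinearMap hinj hfr).toContinuousLinearEquiv, by
    ext; rfl⟩

variable {F : Type*} [NormedAddCommGroup F] [NormedSpace ℝ F]
  {N : Type*} [TopologicalSpace N] [ChartedSpace F N] [IsManifold 𝓘(ℝ, F) ∞ N]
  {g : SmoothMetric E M} {g' : SmoothMetric F N} {f : M → N}

theorem IsIsometricImmersion.contDiffAt (hf : IsIsometricImmersion g g' f) (x : M) :
    ContDiffAt ℝ ∞ (writtenInExtChartAt 𝓘(ℝ, E) 𝓘(ℝ, F) x f) (extChartAt 𝓘(ℝ, E) x x) := by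
  have := (hf.contMDiff x)
  rw [contMDiffAt_iff] at this
  simpa [ModelWithCorners.range_eq_univ, contDiffWithinAt_univ] using this.2

/-- The differential of `f` at `x` as a linear map between the model spaces. -/
noncomputable def differentialAt (f : M → N) (x : M) : E →L[ℝ] F := mfderiv 𝓘(ℝ, E) 𝓘(ℝ, F) f x

theorem IsIsometricImmersion.differentialAt_eq (hf : IsIsometricImmersion g g' f) (x : M) :
    differentialAt f x
      = fderiv ℝ (writtenInExtChartAt 𝓘(ℝ, E) 𝓘(ℝ, F) x f) (extChartAt 𝓘(ℝ, E) x x) := by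
  have h := (hf.contMDiff x).mdifferentiableAt (by simp)
  simp only [differentialAt, mfderiv, h, ModelWithCorners.range_eq_univ, fderivWithin_univ]
  exact if_pos trivial

theorem IsIsometricImmersion.metricBilin_differentialAt (hf : IsIsometricImmersion g g' f) (x : M)
    (u v : E) :
    metricBilin g' (f x) (differentialAt f x u) (differentialAt f x v) = metricBilin g x u v :=
  hf.inner_eq x u v

omit [IsManifold 𝓘(ℝ, E) ∞ M] [IsManifold 𝓘(ℝ, F) ∞ N] in
theorem writtenInExtChartAt_self (f : M → N) (x : M) :
    writtenInExtChartAt 𝓘(ℝ, E) 𝓘(ℝ, F) x f (extChartAt 𝓘(ℝ, E) x x)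
      = extChartAt 𝓘(ℝ, F) (f x) (f x) := by
  simp [writtenInExtChartAt]

theorem IsIsometricImmersion.metricInChart_eq (hf : IsIsometricImmersion g g' f) (x : M) :
    ∀ᶠ z in nhds (extChartAt 𝓘(ℝ, E) x x), ∀ u v, metricInChart g x z u v
      = metricInChart g' (f x) (writtenInExtChartAt 𝓘(ℝ, E) 𝓘(ℝ, F) x f z)
        (fderiv ℝ (writtenInExtChartAt 𝓘(ℝ, E) 𝓘(ℝ, F) x f) z u)
        (fderiv ℝ (writtenInExtChartAt 𝓘(ℝ, E) 𝓘(ℝ, F) x f) z v) := by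
  set φ := writtenInExtChartAt 𝓘(ℝ, E) 𝓘(ℝ, F) x f with hφdef
  set s := (extChartAt 𝓘(ℝ, E) x).symm
  set s' := (extChartAt 𝓘(ℝ, F) (f x)).symm
  have htgt := extChartAt_target_mem_nhds (I := 𝓘(ℝ, E)) x
  have hφ : ∀ᶠ z in nhds (extChartAt 𝓘(ℝ, E) x x), DifferentiableAt ℝ φ z := by
    filter_upwards [((hf.contDiffAt x).of_le (m := 1) (by exact_mod_cast le_top)).eventually
      (by simp)] with z hz
    exact hz.differentiableAt (by norm_num)
  have hsrc : ∀ᶠ z in nhds (extChartAt 𝓘(ℝ, E) x x),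
      f (s z) ∈ (extChartAt 𝓘(ℝ, F) (f x)).source := by
    have hc : ContinuousAt (fun z => f (s z)) (extChartAt 𝓘(ℝ, E) x x) :=
      hf.contMDiff.continuous.continuousAt.comp (continuousAt_extChartAt_symm x)
    refine hc.eventually ?_
    have hx : s (extChartAt 𝓘(ℝ, E) x x) = x := extChartAt_to_inv x
    simp only [hx]
    exact extChartAt_source_mem_nhds _
  filter_upwards [htgt, hφ, hsrc.eventually_nhds] with z hz hφz hsz u v
  have hφt : φ z ∈ (extChartAt 𝓘(ℝ, F) (f x)).target :=
    (extChartAt 𝓘(ℝ, F) (f x)).map_source hsz.self_of_nhds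
  have hds : MDifferentiableAt 𝓘(ℝ, E) 𝓘(ℝ, E) s z :=
    ((contMDiffOn_extChartAt_symm (n := ∞) x).contMDiffAt
      ((isOpen_extChartAt_target x).mem_nhds hz)).mdifferentiableAt (by simp)
  have hds' : MDifferentiableAt 𝓘(ℝ, F) 𝓘(ℝ, F) s' (φ z) :=
    ((contMDiffOn_extChartAt_symm (n := ∞) (f x)).contMDiffAt
      ((isOpen_extChartAt_target (f x)).mem_nhds hφt)).mdifferentiableAt (by simp)
  have hdf : MDifferentiableAt 𝓘(ℝ, E) 𝓘(ℝ, F) f (s z) :=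
    (hf.contMDiff _).mdifferentiableAt (by simp)
  have heq : (f ∘ s) =ᶠ[nhds z] (s' ∘ φ) := hsz.mono fun w hw =>
    ((extChartAt 𝓘(ℝ, F) (f x)).left_inv hw).symm
  have h1 := mfderiv_comp z hdf hds
  have h2 := mfderiv_comp z hds' hφz.mdifferentiableAt
  rw [mfderiv_eq_fderiv] at h2
  have h3 := heq.mfderiv_eq (I := 𝓘(ℝ, E)) (I' := 𝓘(ℝ, F))
  have h4 : ∀ w : E, (show F from mfderiv 𝓘(ℝ, E) 𝓘(ℝ, F) f (s z) (mfderiv 𝓘(ℝ, E) 𝓘(ℝ, E) s z w))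
      = mfderiv 𝓘(ℝ, F) 𝓘(ℝ, F) s' (φ z) (fderiv ℝ φ z w) := by
    intro w
    have h5 := congrArg (fun L : E →L[ℝ] F => L w) h1
    have h6 := congrArg (fun L : E →L[ℝ] F => L w) h2
    have h7 := congrArg (fun L : E →L[ℝ] F => L w) h3
    exact h5.symm.trans (h7.trans h6)
  have h8 : ∀ p q : N, p = q → ∀ a b : F, metricBilin g' p a b = metricBilin g' q a b := by
    rintro p q rfl a b
    rfl
  refine (hf.inner_eq (s z) (mfderiv 𝓘(ℝ, E) 𝓘(ℝ, E) s z u)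
    (mfderiv 𝓘(ℝ, E) 𝓘(ℝ, E) s z v)).symm.trans ?_
  refine (h8 _ _ heq.self_of_nhds _ _).trans ?_
  exact congrArg₂ (fun a b : F => metricBilin g' (s' (φ z)) a b) (h4 u) (h4 v)

variable (g g' f) in
/-- The second fundamental form as a bilinear map between the model spaces. -/
noncomputable def secondForm (x : M) : E →L[ℝ] E →L[ℝ] F := secondFundamentalForm g g' f x

theorem IsIsometricImmersion.secondForm_apply (hf : IsIsometricImmersion g g' f) (x : M) (u v : E) :
    secondForm g g' f x u v
      = fderiv ℝ (fderiv ℝ (writtenInExtChartAt 𝓘(ℝ, E) 𝓘(ℝ, F) x f)) (extChartAt 𝓘(ℝ, E) x x) u v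
      + christoffel (metricInChart g' (f x)) (extChartAt 𝓘(ℝ, F) (f x) (f x))
          (differentialAt f x u) (differentialAt f x v)
      - differentialAt f x (christoffel (metricInChart g x) (extChartAt 𝓘(ℝ, E) x x) u v) := by
  rw [hf.differentialAt_eq, ← writtenInExtChartAt_self (E := E)]
  rfl

variable [FiniteDimensional ℝ E] [FiniteDimensional ℝ F]

theorem IsIsometricImmersion.secondForm_symm (hf : IsIsometricImmersion g g' f) (x : M)
    (u v : E) : secondForm g g' f x u v = secondForm g g' f x v u := by
  have h1 := ((hf.contDiffAt x).isSymmSndFDerivAt (by simpa using two_le_infty)).eq u v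
  have h2 := christoffel_symm ((contDiffAt_metricInChart g x).differentiableAt (by simp))
    (metricInChart_symm g x) u v
  rw [hf.secondForm_apply, hf.secondForm_apply, h1, h2,
    christoffel_symm ((contDiffAt_metricInChart g' (f x)).differentiableAt (by simp))
      (metricInChart_symm g' (f x))]

theorem IsIsometricImmersion.secondForm_normal (hf : IsIsometricImmersion g g' f)
    (x : M) (u v w : E) :
    metricBilin g' (f x) (secondForm g g' f x u v) (differentialAt f x w) = 0 := by
  have h := pullback_normal (φ := writtenInExtChartAt 𝓘(ℝ, E) 𝓘(ℝ, F) x f)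
    ((contDiffAt_metricInChart g x).differentiableAt (by simp))
    (isInvertible_metricInChart g x)
    (G' := metricInChart g' (f x))
    (by rw [writtenInExtChartAt_self]
        exact (contDiffAt_metricInChart g' (f x)).differentiableAt (by simp))
    (by rw [writtenInExtChartAt_self]; exact isInvertible_metricInChart g' (f x))
    (metricInChart_symm g' (f x)) ((hf.contDiffAt x).of_le two_le_infty)
    (hf.metricInChart_eq x) u v w
  rwa [writtenInExtChartAt_self, metricInChart_self, ← hf.differentialAt_eq,
    ← hf.secondForm_apply] at h

/-- The Gauss equation. -/
theorem IsIsometricImmersion.sectionalCurvature_eq (hf : IsIsometricImmersion g g' f)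
    (x : M) (u v : E) :
    sectionalCurvature g x u v
      = sectionalCurvature g' (f x) (differentialAt (F := F) f x u) (differentialAt (F := F) f x v)
        + metricBilin g' (f x) (secondForm g g' f x u u) (secondForm g g' f x v v)
        - metricBilin g' (f x) (secondForm g g' f x u v) (secondForm g g' f x u v) := by
  have h := gauss_equation_coordinates (φ := writtenInExtChartAt 𝓘(ℝ, E) 𝓘(ℝ, F) x f)
    ((contDiffAt_metricInChart g x).of_le two_le_infty)
    (isInvertible_metricInChart g x) (metricInChart_symm g x)
    (G' := metricInChart g' (f x))
    (by rw [writtenInExtChartAt_self]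
        exact (contDiffAt_metricInChart g' (f x)).of_le two_le_infty)
    (by rw [writtenInExtChartAt_self]; exact isInvertible_metricInChart g' (f x))
    (metricInChart_symm g' (f x)) ((hf.contDiffAt x).of_le three_le_infty)
    (hf.metricInChart_eq x) (h := fun u v => secondForm g g' f x u v)
    (fun u v => by
      rw [hf.secondForm_apply, ← hf.differentialAt_eq, writtenInExtChartAt_self]) u v
  rw [writtenInExtChartAt_self, metricInChart_self, metricInChart_self,
    ← hf.differentialAt_eq] at h
  exact h

end Charts

section Frames

variable {V : Type*} [AddCommGroup V] [Module ℝ V] {ι ι' : Type*}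

/-- `e` is orthonormal for the bilinear form `b`. -/
def IsOrthonormalFor (b : V → V → ℝ) (e : ι → V) : Prop :=
  (∀ i, b (e i) (e i) = 1) ∧ ∀ i j, i ≠ j → b (e i) (e j) = 0

/-- A partial orthonormal frame extends to an orthonormal frame. -/
theorem exists_isOrthonormalFor_extension [FiniteDimensional ℝ V] [Fintype ι]
    (B : LinearMap.BilinForm ℝ V) (hs : ∀ u v, B u v = B v u) (hpos : ∀ u, u ≠ 0 → 0 < B u u)
    (hcard : Module.finrank ℝ V = Fintype.card ι) (v : ι → V) (s : Set ι)
    (hv : IsOrthonormalFor (fun u v => B u v) (s.domRestrict v)) :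
    ∃ e : ι → V, IsOrthonormalFor (fun u v => B u v) e ∧ ∀ i ∈ s, e i = v i := by
  classical
  let core : InnerProductSpace.Core ℝ V :=
    { inner := fun u v => B u v
      conj_inner_symm := fun u v => by simpa using hs v u
      re_inner_nonneg := fun u => by
        by_cases hu : u = 0
        · simp [hu]
        · simpa using (hpos u hu).le
      add_left := fun u v w => by simp
      smul_left := fun u v r => by simp
      definite := fun u hu => by
        by_contra h
        exact (hpos u h).ne' hu }
  let := core.toNormedAddCommGroup
  let : InnerProductSpace ℝ V := InnerProductSpace.ofCore core.toCore
  have hin : ∀ u v : V, inner ℝ u v = B u v := fun _ _ => rfl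
  have hv' : Orthonormal ℝ (s.domRestrict v) := by
    rw [orthonormal_iff_ite]
    intro i j
    rw [hin]
    split_ifs with h
    · rw [h]; exact hv.1 j
    · exact hv.2 i j h
  obtain ⟨e, he⟩ := hv'.exists_orthonormalBasis_extension_of_card_eq hcard
  have h1 := orthonormal_iff_ite.1 e.orthonormal
  refine ⟨e, ⟨fun i => ?_, fun i j hij => ?_⟩, he⟩
  · exact (h1 i i).trans (if_pos rfl)
  · exact (h1 i j).trans (if_neg hij)

/-- Expansion of a vector in an orthonormal frame. -/
theorem IsOrthonormalFor.sum_smul_eq [FiniteDimensional ℝ V] [Fintype ι]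
    {B : LinearMap.BilinForm ℝ V} {e : ι → V}
    (he : IsOrthonormalFor (fun u v => B u v) e)
    (hcard : Module.finrank ℝ V = Fintype.card ι) (u : V) : ∑ i, B u (e i) • e i = u := by
  classical
  have hB : ∀ i j, B (e i) (e j) = if i = j then 1 else 0 := fun i j => by
    split_ifs with h
    · rw [h]; exact he.1 j
    · exact he.2 i j h
  have hli : LinearIndependent ℝ e := by
    rw [Fintype.linearIndependent_iff]
    intro c hc j
    have := congrArg (fun w => B w (e j)) hc
    simpa [hB] using this
  have hsp : Submodule.span ℝ (Set.range e) = ⊤ :=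
    hli.span_eq_top_of_card_eq_finrank' hcard.symm
  have hu : u ∈ Submodule.span ℝ (Set.range e) := hsp ▸ Submodule.mem_top
  obtain ⟨c, rfl⟩ := (Submodule.mem_span_range_iff_exists_fun ℝ).1 hu
  refine Finset.sum_congr rfl fun j _ => ?_
  simp [hB]

theorem IsOrthonormalFor.sum_mul_eq [FiniteDimensional ℝ V] [Fintype ι]
    {B : LinearMap.BilinForm ℝ V}
    (hs : ∀ u v, B u v = B v u) {e : ι → V} (he : IsOrthonormalFor (fun u v => B u v) e)
    (hcard : Module.finrank ℝ V = Fintype.card ι) (u v : V) :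
    ∑ i, B u (e i) * B v (e i) = B u v := by
  conv_rhs => rw [← he.sum_smul_eq hcard u]
  simp [hs v]

/-- The trace of a bilinear map does not depend on the orthonormal frame. -/
theorem IsOrthonormalFor.trace_eq [FiniteDimensional ℝ V] [Fintype ι] [Fintype ι']
    {X : Type*} [AddCommGroup X] [Module ℝ X] {B : LinearMap.BilinForm ℝ V}
    (hs : ∀ u v, B u v = B v u) {e : ι → V} {e' : ι' → V}
    (he : IsOrthonormalFor (fun u v => B u v) e) (he' : IsOrthonormalFor (fun u v => B u v) e')
    (hcard : Module.finrank ℝ V = Fintype.card ι) (hcard' : Module.finrank ℝ V = Fintype.card ι')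
    (T : V →ₗ[ℝ] V →ₗ[ℝ] X) : ∑ i, T (e i) (e i) = ∑ i, T (e' i) (e' i) := by
  have h1 : ∀ i, T (e i) (e i) = ∑ j, B (e' j) (e i) • T (e' j) (e i) := fun i => by
    conv_lhs => enter [1]; rw [← he'.sum_smul_eq hcard' (e i)]
    simp [hs (e i)]
  have h2 : ∀ j, T (e' j) (e' j) = ∑ i, B (e' j) (e i) • T (e' j) (e i) := fun j => by
    conv_lhs => enter [2]; rw [← he.sum_smul_eq hcard (e' j)]
    simp
  simp only [h1, h2]
  exact Finset.sum_comm

end Frames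

section Sums

theorem two_mul_sum_Ioi {k : ℕ} (f : Fin k → Fin k → ℝ) (hf : ∀ i j, f i j = f j i) :
    2 * ∑ i, ∑ j ∈ Finset.Ioi i, f i j = ∑ i, ∑ j, f i j - ∑ i, f i i := by
  have h1 : ∀ i, ∑ j, f i j
      = ∑ j ∈ Finset.Ioi i, f i j + f i i + ∑ j ∈ Finset.Iio i, f i j := by
    intro i
    have : (Finset.univ : Finset (Fin k)) = Finset.Ici i ∪ Finset.Iio i := by
      ext j; simp [le_or_gt]
    rw [this, Finset.sum_union, ← Finset.Ioi_insert, Finset.sum_insert (by simp)]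
    · ring
    · rw [Finset.disjoint_left]
      intro j; simp
  have h2 : ∑ i, ∑ j ∈ Finset.Iio i, f i j = ∑ i, ∑ j ∈ Finset.Ioi i, f i j := by
    rw [Finset.sum_comm' (t' := Finset.univ) (s' := fun j => Finset.Ioi j) (by simp)]
    simp only [hf]
  simp only [h1, Finset.sum_add_distrib, h2]
  ring

theorem sq_add_sq_add_two_mul_nonneg {a : ℝ} (ha : a ∈ Set.Ioo (-1 : ℝ) 1) (p q : ℝ) :
    0 ≤ p ^ 2 + q ^ 2 + 2 * a * (p * q) := by
  have h1 := mul_nonneg (by linarith [ha.1] : (0 : ℝ) ≤ 1 + a) (sq_nonneg (p + q))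
  have h2 := mul_nonneg (by linarith [ha.2] : (0 : ℝ) ≤ 1 - a) (sq_nonneg (p - q))
  linear_combination (1 / 2) * h1 + (1 / 2) * h2

theorem eq_zero_of_sq_add_sq_add_two_mul_eq_zero {a : ℝ} (ha : a ∈ Set.Ioo (-1 : ℝ) 1) {p q : ℝ}
    (h : p ^ 2 + q ^ 2 + 2 * a * (p * q) = 0) : p = 0 ∧ q = 0 := by
  have h1 := mul_nonneg (by linarith [ha.1] : (0 : ℝ) ≤ 1 + a) (sq_nonneg (p + q))
  have h2 := mul_nonneg (by linarith [ha.2] : (0 : ℝ) ≤ 1 - a) (sq_nonneg (p - q))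
  have h3 : (1 + a) * (p + q) ^ 2 = 0 := le_antisymm (by linear_combination 2 * h + h2) h1
  have h4 : (1 - a) * (p - q) ^ 2 = 0 := le_antisymm (by linear_combination 2 * h + h1) h2
  have h5 : p + q = 0 := by
    rcases mul_eq_zero.1 h3 with h | h
    · linarith [ha.1]
    · simpa using h
  have h6 : p - q = 0 := by
    rcases mul_eq_zero.1 h4 with h | h
    · linarith [ha.2]
    · simpa using h
  constructor <;> linarith

/-- The algebraic inequality for one Weingarten matrix, with its equality case. -/
theorem weingarten_inequality {n : ℕ} (hn : 3 ≤ n) {a : ℝ} (ha : a ∈ Set.Ioo (-1 : ℝ) 1)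
    (h : Fin n → Fin n → ℝ) (hh : ∀ i j, h i j = h j i) {i₀ i₁ : Fin n} (h₀ : (i₀ : ℕ) = 0)
    (h₁ : (i₁ : ℕ) = 1) {Q R : ℝ}
    (hQ : Q = ∑ i, ∑ j ∈ Finset.Ioi i, (h i i * h j j - h i j * h i j)
      - a * (h i₀ i₀ * h i₁ i₁ - h i₀ i₁ * h i₀ i₁))
    (hR : R = (n * (a + 1) - 3 * a - 1) / (n * (a + 1) - 2 * a) * ((∑ i, h i i) ^ 2 / 2)) :
    Q ≤ R ∧ (Q = R ↔ (∀ i j, i ≠ j → h i j = 0) ∧ (a + 1) * h i₀ i₀ = (a + 1) * h i₁ i₁ ∧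
      ∀ i : Fin n, 2 ≤ (i : ℕ) → h i i = (a + 1) * h i₀ i₀) := by
  obtain ⟨k, rfl⟩ : ∃ k, n = k + 2 := ⟨n - 2, by omega⟩
  obtain rfl : i₀ = 0 := Fin.ext h₀
  obtain rfl : i₁ = 1 := Fin.ext h₁
  have ha1 := ha.1
  have ha2 := ha.2
  have hk : (1 : ℝ) ≤ k := by exact_mod_cast (by omega : 1 ≤ k)
  set d : ℝ := (k + 2 : ℕ) * (a + 1) - 2 * a with hd
  have hdk : d = k * (a + 1) + 2 := by rw [hd]; push_cast; ring
  have hdpos : 0 < d := by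
    have := mul_nonneg (by linarith : (0 : ℝ) ≤ k) (by linarith : 0 ≤ a + 1)
    rw [hdk]
    linarith
  set S := ∑ i, h i i with hS
  set t := S / d with ht
  have htd : S = t * d := by rw [ht]; field_simp
  have hSs : S = h 0 0 + h 1 1 + ∑ i : Fin k, h i.succ.succ i.succ.succ := by
    rw [hS, Fin.sum_univ_succ, Fin.sum_univ_succ]; simp [add_assoc]
  set z : Fin k → ℝ := fun i => h i.succ.succ i.succ.succ - (a + 1) * t with hz
  set off := ∑ i, ∑ j ∈ Finset.Ioi i, h i j ^ 2 - a * h 0 1 ^ 2 with hoff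
  set P := (h 0 0 - t) ^ 2 + (h 1 1 - t) ^ 2 + 2 * a * ((h 0 0 - t) * (h 1 1 - t))
    + ∑ i, z i ^ 2 with hP
  have key : R - Q = P / 2 + off := by
    have e1 : 2 * ∑ i, ∑ j ∈ Finset.Ioi i, h i i * h j j = S ^ 2 - ∑ i, h i i ^ 2 := by
      rw [two_mul_sum_Ioi _ (fun i j => mul_comm _ _), hS, sq, Finset.sum_mul_sum]
      simp [sq]
    have e2 : ∑ i, h i i ^ 2
        = h 0 0 ^ 2 + h 1 1 ^ 2 + ∑ i : Fin k, h i.succ.succ i.succ.succ ^ 2 := by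
      rw [Fin.sum_univ_succ, Fin.sum_univ_succ]; simp [add_assoc]
    have e3 : ∑ i, z i ^ 2 = ∑ i : Fin k, h i.succ.succ i.succ.succ ^ 2
        - 2 * ((a + 1) * t) * ∑ i : Fin k, h i.succ.succ i.succ.succ + k * ((a + 1) * t) ^ 2 := by
      simp only [hz, sub_sq, Finset.sum_add_distrib, Finset.sum_sub_distrib, Finset.mul_sum]
      simp only [Finset.sum_const, Finset.card_univ, Fintype.card_fin, nsmul_eq_mul]
      congr 2
      exact Finset.sum_congr rfl fun i _ => by ring
    have e4 : R = (d - (a + 1)) * t ^ 2 * d / 2 := by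
      rw [hR, htd, hd]
      rw [hd] at hdpos
      field_simp
      ring
    have e5 : ∑ i, ∑ j ∈ Finset.Ioi i, (h i i * h j j - h i j * h i j)
        = ∑ i, ∑ j ∈ Finset.Ioi i, h i i * h j j - ∑ i, ∑ j ∈ Finset.Ioi i, h i j ^ 2 := by
      simp only [Finset.sum_sub_distrib, sq]
    have e6 : ∑ i : Fin k, h i.succ.succ i.succ.succ = t * d - h 0 0 - h 1 1 := by
      rw [← htd, hSs]; ring
    rw [e4, hQ, hP, hoff, e3, e5, e6]
    rw [e2, htd] at e1
    linear_combination (-1 / 2) * e1 + (1 / 2) * (a + 1) * t^2 * hdk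
  have hP0 := sq_add_sq_add_two_mul_nonneg ha
  have hz0 : 0 ≤ ∑ i, z i ^ 2 := Finset.sum_nonneg fun i _ => sq_nonneg _
  have hPnn : 0 ≤ P := by
    rw [hP]; linarith [hP0 (h 0 0 - t) (h 1 1 - t)]
  have hoffs : (1 - a) * h 0 1 ^ 2 ≤ off := by
    have f1 : ∑ j ∈ Finset.Ioi (0 : Fin (k + 2)), h 0 j ^ 2
        ≤ ∑ i, ∑ j ∈ Finset.Ioi i, h i j ^ 2 :=
      Finset.single_le_sum (f := fun i => ∑ j ∈ Finset.Ioi i, h i j ^ 2)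
        (fun i _ => Finset.sum_nonneg fun j _ => sq_nonneg _) (Finset.mem_univ 0)
    have f2 : h 0 1 ^ 2 ≤ ∑ j ∈ Finset.Ioi (0 : Fin (k + 2)), h 0 j ^ 2 :=
      Finset.single_le_sum (f := fun j => h 0 j ^ 2) (fun j _ => sq_nonneg _) (by simp)
    rw [hoff]; linarith
  have hoffnn : 0 ≤ off :=
    (mul_nonneg (by linarith) (sq_nonneg _)).trans hoffs
  refine ⟨by linarith, fun hQR => ?_, fun ⟨c1, c2, c3⟩ => ?_⟩
  · have g1 : P = 0 := by linarith
    have g2 : off = 0 := by linarith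
    have g3 : h 0 1 ^ 2 = 0 := by
      have : (1 - a) * h 0 1 ^ 2 = 0 :=
        le_antisymm (by linarith) (mul_nonneg (by linarith) (sq_nonneg _))
      exact (mul_eq_zero.1 this).resolve_left (by linarith)
    have g4 : ∑ i, ∑ j ∈ Finset.Ioi i, h i j ^ 2 = 0 := by
      rw [hoff, g3] at g2; linarith
    have g5 : ∀ i j, i < j → h i j = 0 := fun i j hij => by
      have := (Finset.sum_eq_zero_iff_of_nonneg
        (fun i _ => Finset.sum_nonneg fun j _ => sq_nonneg (h i j))).1 g4 i (Finset.mem_univ i)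
      have := (Finset.sum_eq_zero_iff_of_nonneg (fun j _ => sq_nonneg (h i j))).1 this j (by simpa)
      simpa using this
    have g6 : (h 0 0 - t) ^ 2 + (h 1 1 - t) ^ 2 + 2 * a * ((h 0 0 - t) * (h 1 1 - t)) = 0 := by
      linarith [hP0 (h 0 0 - t) (h 1 1 - t)]
    have g7 : ∑ i, z i ^ 2 = 0 := by linarith [hP0 (h 0 0 - t) (h 1 1 - t)]
    obtain ⟨g8, g9⟩ := eq_zero_of_sq_add_sq_add_two_mul_eq_zero ha g6
    have g11 : h 0 0 = t := by linarith
    have g12 : h 1 1 = t := by linarith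
    refine ⟨fun i j hij => ?_, by rw [g11, g12], fun i hi => ?_⟩
    · rcases lt_or_gt_of_ne hij with hlt | hlt
      · exact g5 i j hlt
      · rw [hh]; exact g5 j i hlt
    · obtain ⟨j, rfl⟩ : ∃ j : Fin k, i = j.succ.succ :=
        ⟨⟨i - 2, by omega⟩, Fin.ext (by simp; omega)⟩
      have := (Finset.sum_eq_zero_iff_of_nonneg (fun i _ => sq_nonneg (z i))).1 g7 j
        (Finset.mem_univ j)
      have : z j = 0 := by simpa using this
      rw [g11]
      simp only [hz] at this
      linarith
  · have g1 : h 1 1 = h 0 0 := by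
      have := mul_left_cancel₀ (by linarith : a + 1 ≠ 0) c2
      exact this.symm
    have g2 : ∀ j : Fin k, h j.succ.succ j.succ.succ = (a + 1) * h 0 0 := fun j =>
      c3 _ (by simp)
    have g3 : t = h 0 0 := by
      rw [ht, hSs, g1]
      simp only [g2, Finset.sum_const, Finset.card_univ, Fintype.card_fin, nsmul_eq_mul]
      rw [div_eq_iff hdpos.ne', hdk]
      ring
    have g4 : P = 0 := by
      rw [hP]
      simp [hz, g1, g2, g3]
    have g5 : off = 0 := by
      rw [hoff, c1 0 1 (by simp), Finset.sum_eq_zero]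
      · simp
      · intro i _
        refine Finset.sum_eq_zero fun j hj => ?_
        rw [c1 i j (Finset.mem_Ioi.1 hj).ne]
        simp
    linarith

end Sums

section Submanifolds

variable {E : Type*} [NormedAddCommGroup E] [NormedSpace ℝ E]
  {M : Type*} [TopologicalSpace M] [ChartedSpace E M] [IsManifold 𝓘(ℝ, E) ∞ M]
  {F : Type*} [NormedAddCommGroup F] [NormedSpace ℝ F]
  {N : Type*} [TopologicalSpace N] [ChartedSpace F N] [IsManifold 𝓘(ℝ, F) ∞ N]
  {g : SmoothMetric E M} {g' : SmoothMetric F N} {f : M → N}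

/-- The metric at `x` as a bilinear form in the algebraic sense. -/
noncomputable def metricForm (g : SmoothMetric E M) (x : M) : LinearMap.BilinForm ℝ E :=
  (metricBilin g x).toLinearMap₁₂

theorem metricForm_symm (g : SmoothMetric E M) (x : M) (u v : E) :
    metricForm g x u v = metricForm g x v u :=
  metricBilin_symm g x u v

theorem isOrthonormal_pair {x : M} {u v : E} :
    IsOrthonormal g x ![u, v] ↔
      metricForm g x u u = 1 ∧ metricForm g x v v = 1 ∧ metricForm g x u v = 0 := by
  constructor
  · rintro ⟨h1, h2⟩
    exact ⟨h1 0, h1 1, h2 0 1 (by decide)⟩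
  · rintro ⟨h1, h2, h3⟩
    refine ⟨fun i => ?_, fun i j hij => ?_⟩
    · fin_cases i
      exacts [h1, h2]
    · fin_cases i <;> fin_cases j
      · exact absurd rfl hij
      · exact h3
      · exact (metricForm_symm g x v u).trans h3
      · exact absurd rfl hij

theorem IsOrthonormalFor.pair {ι : Type*} {x : M} {e : ι → E}
    (he : IsOrthonormalFor (fun u v => metricForm g x u v) e) {i j : ι} (hij : i ≠ j) :
    IsOrthonormal g x ![e i, e j] :=
  isOrthonormal_pair.2 ⟨he.1 i, he.1 j, he.2 i j hij⟩

variable [FiniteDimensional ℝ E]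

theorem metricBilin_weingarten (x : M) (ξ : F) (u v : E) :
    g.inner x (weingarten g g' f x ξ u) v = metricForm g' (f x) ξ (secondForm g g' f x u v) := by
  have hi := isInvertible_metricInChart g x
  rw [metricInChart_self] at hi
  have h := hi.self_apply_inverse ((metricBilin g' (f x) ξ).comp (secondForm g g' f x u))
  exact congrArg (fun L : E →L[ℝ] ℝ => L v) h

theorem exists_orthonormalFrame_pair {k : ℕ} (hk : Module.finrank ℝ E = k) (x : M) {u v : E}
    (huv : IsOrthonormal g x ![u, v]) {i j : Fin k} (hij : i ≠ j) :
    ∃ e : Fin k → E, IsOrthonormalFor (fun u v => metricForm g x u v) e ∧ e i = u ∧ e j = v := by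
  obtain ⟨h1, h2, h3⟩ := isOrthonormal_pair.1 huv
  let w : Fin k → E := fun l => if l = i then u else v
  have hwi : w i = u := if_pos rfl
  have hwj : w j = v := if_neg hij.symm
  obtain ⟨e, he, hev⟩ := exists_isOrthonormalFor_extension (metricForm g x) (metricForm_symm g x)
    (metricBilin_pos g x) (by simpa using hk) w {i, j} (by
      constructor
      · rintro ⟨l, rfl | rfl⟩
        · simpa [hwi] using h1
        · simpa [hwj] using h2
      · rintro ⟨l, rfl | rfl⟩ ⟨l', rfl | rfl⟩ hl
        · exact absurd rfl hl
        · simpa [hwi, hwj] using h3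
        · simpa [hwi, hwj] using (metricForm_symm g x v u).trans h3
        · exact absurd rfl hl)
  exact ⟨e, he, (hev i (by simp)).trans hwi, (hev j (by simp)).trans hwj⟩

variable [FiniteDimensional ℝ F]

omit [FiniteDimensional ℝ E] in
theorem IsIsometricImmersion.finrank_le (hf : IsIsometricImmersion g g' f) (x : M) :
    Module.finrank ℝ E ≤ Module.finrank ℝ F := by
  refine LinearMap.finrank_le_finrank_of_injective
    (f := (differentialAt f x : E →L[ℝ] F).toLinearMap) ?_
  rw [injective_iff_map_eq_zero]
  intro u hu
  by_contra h0
  have h1 := metricBilin_pos g x u h0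
  rw [← hf.metricBilin_differentialAt] at h1
  rw [show (differentialAt f x : E →L[ℝ] F) u = 0 from hu] at h1
  simp at h1

omit [FiniteDimensional ℝ E] [FiniteDimensional ℝ F] in
theorem IsIsometricImmersion.isOrthonormalFor_sumElim (hf : IsIsometricImmersion g g' f) {x : M}
    {ι κ : Type*} {e : ι → E} {ξ : κ → F}
    (he : IsOrthonormalFor (fun u v => metricForm g x u v) e)
    (hξ : IsOrthonormalFor (fun u v => metricForm g' (f x) u v) ξ)
    (hn : ∀ r (u : E), metricForm g' (f x) (differentialAt f x u) (ξ r) = 0) :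
    IsOrthonormalFor (fun u v => metricForm g' (f x) u v)
      (Sum.elim (fun i => differentialAt f x (e i)) ξ) := by
  constructor
  · rintro (i | r)
    · exact (hf.metricBilin_differentialAt x _ _).trans (he.1 i)
    · exact hξ.1 r
  · rintro (i | r) (j | s) hij
    · exact (hf.metricBilin_differentialAt x _ _).trans (he.2 i j fun h => hij (h ▸ rfl))
    · exact hn s (e i)
    · exact (metricForm_symm g' (f x) _ _).trans (hn r (e j))
    · exact hξ.2 r s fun h => hij (h ▸ rfl)

theorem IsIsometricImmersion.exists_normalFrame (hf : IsIsometricImmersion g g' f)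
    {x : M} {k l : ℕ}
    (hk : Module.finrank ℝ E = k) (hl : Module.finrank ℝ F = k + l) {e : Fin k → E}
    (he : IsOrthonormalFor (fun u v => metricForm g x u v) e) :
    ∃ ξ : Fin l → F, IsOrthonormalFor (fun u v => metricForm g' (f x) u v) ξ ∧
      ∀ r (u : E), metricForm g' (f x) (differentialAt f x u) (ξ r) = 0 := by
  obtain ⟨b, hb, hbe⟩ := exists_isOrthonormalFor_extension (metricForm g' (f x))
    (metricForm_symm g' (f x)) (metricBilin_pos g' (f x)) (ι := Fin k ⊕ Fin l) (by simpa using hl)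
    (Sum.elim (fun i => differentialAt f x (e i)) 0) (Set.range Sum.inl) (by
      constructor
      · rintro ⟨_, i, rfl⟩
        exact (hf.metricBilin_differentialAt x _ _).trans (he.1 i)
      · rintro ⟨_, i, rfl⟩ ⟨_, j, rfl⟩ hij
        exact (hf.metricBilin_differentialAt x _ _).trans
          (he.2 i j fun h => hij (by subst h; rfl)))
  refine ⟨fun r => b (Sum.inr r), ⟨fun r => hb.1 _, fun r s hrs => hb.2 _ _ (by simpa using hrs)⟩,
    fun r u => ?_⟩
  rw [← he.sum_smul_eq (by simpa using hk) u]
  simp only [map_sum, map_smul, LinearMap.sum_apply, LinearMap.smul_apply]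
  refine Finset.sum_eq_zero fun i _ => ?_
  have h1 : b (Sum.inl i) = differentialAt f x (e i) := hbe _ ⟨i, rfl⟩
  rw [← h1, show metricForm g' (f x) (b (Sum.inl i)) (b (Sum.inr r)) = 0 from
    hb.2 _ _ (by simp), smul_zero]

variable {c : ℝ}

theorem IsIsometricImmersion.sectionalCurvature_spaceForm (hf : IsIsometricImmersion g g' f)
    (hc : IsSpaceForm g' c) (x : M) {u v : E} (huv : IsOrthonormal g x ![u, v]) :
    sectionalCurvature g x u v = c
      + metricForm g' (f x) (secondForm g g' f x u u) (secondForm g g' f x v v)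
      - metricForm g' (f x) (secondForm g g' f x u v) (secondForm g g' f x u v) := by
  obtain ⟨h1, h2, h3⟩ := isOrthonormal_pair.1 huv
  rw [hf.sectionalCurvature_eq, hc (f x) (differentialAt (F := F) f x u)
    (differentialAt (F := F) f x v) (isOrthonormal_pair.2
      ⟨(hf.metricBilin_differentialAt x u u).trans h1,
        (hf.metricBilin_differentialAt x v v).trans h2,
        (hf.metricBilin_differentialAt x u v).trans h3⟩)]
  rfl

theorem sum_Ioi_const (k : ℕ) (c : ℝ) :
    ∑ i : Fin k, ∑ _j ∈ Finset.Ioi i, c = ((k : ℝ) ^ 2 - k) * c / 2 := by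
  have h := two_mul_sum_Ioi (fun _ _ : Fin k => c) (fun _ _ => rfl)
  simp only [Finset.sum_const, Finset.card_univ, Fintype.card_fin, nsmul_eq_mul] at h ⊢
  linear_combination h / 2

theorem IsIsometricImmersion.sum_sectionalCurvature (hf : IsIsometricImmersion g g' f)
    (hc : IsSpaceForm g' c) (x : M) {k : ℕ} {e : Fin k → E}
    (he : IsOrthonormalFor (fun u v => metricForm g x u v) e) :
    ∑ i, ∑ j ∈ Finset.Ioi i, sectionalCurvature g x (e i) (e j)
      = ((k : ℝ) ^ 2 - k) * c / 2 + (metricForm g' (f x) (∑ i, secondForm g g' f x (e i) (e i))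
          (∑ i, secondForm g g' f x (e i) (e i))
        - ∑ i, ∑ j, metricForm g' (f x) (secondForm g g' f x (e i) (e j))
          (secondForm g g' f x (e i) (e j))) / 2 := by
  set R : Fin k → Fin k → ℝ := fun i j =>
    metricForm g' (f x) (secondForm g g' f x (e i) (e i)) (secondForm g g' f x (e j) (e j))
      - metricForm g' (f x) (secondForm g g' f x (e i) (e j)) (secondForm g g' f x (e i) (e j))
    with hR
  have h1 : ∀ i, ∀ j ∈ Finset.Ioi i, sectionalCurvature g x (e i) (e j) = c + R i j := by
    intro i j hj
    rw [hf.sectionalCurvature_spaceForm hc x (he.pair (Finset.mem_Ioi.1 hj).ne), add_sub_assoc]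
  have h2 := two_mul_sum_Ioi R fun i j => by
    simp only [hR]
    rw [metricForm_symm, hf.secondForm_symm x (e i) (e j)]
  have h3 : ∑ i, R i i = 0 := Finset.sum_eq_zero fun i _ => by simp [hR]
  have h4 : ∑ i, ∑ j, R i j = metricForm g' (f x) (∑ i, secondForm g g' f x (e i) (e i))
          (∑ i, secondForm g g' f x (e i) (e i))
        - ∑ i, ∑ j, metricForm g' (f x) (secondForm g g' f x (e i) (e j))
          (secondForm g g' f x (e i) (e j)) := by
    simp only [hR, Finset.sum_sub_distrib, map_sum, LinearMap.sum_apply]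
    rw [Finset.sum_comm]
  rw [Finset.sum_congr rfl fun i _ => Finset.sum_congr rfl (h1 i)]
  simp only [Finset.sum_add_distrib]
  rw [sum_Ioi_const, ← h4]
  linear_combination h2 / 2 - h3 / 2

omit [FiniteDimensional ℝ F] in
theorem sum_secondForm_eq (x : M) {ι ι' : Type*} [Fintype ι] [Fintype ι']
    {e : ι → E} {e' : ι' → E}
    (he : IsOrthonormalFor (fun u v => metricForm g x u v) e)
    (he' : IsOrthonormalFor (fun u v => metricForm g x u v) e')
    (hcard : Module.finrank ℝ E = Fintype.card ι) (hcard' : Module.finrank ℝ E = Fintype.card ι') :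
    ∑ i, secondForm g g' f x (e i) (e i) = ∑ i, secondForm g g' f x (e' i) (e' i) :=
  he.trace_eq (metricForm_symm g x) he' hcard hcard' (secondForm g g' f x).toLinearMap₁₂

omit [FiniteDimensional ℝ F] in
theorem sum_sq_secondForm_eq (x : M) {ι ι' : Type*} [Fintype ι] [Fintype ι']
    {e : ι → E} {e' : ι' → E}
    (he : IsOrthonormalFor (fun u v => metricForm g x u v) e)
    (he' : IsOrthonormalFor (fun u v => metricForm g x u v) e')
    (hcard : Module.finrank ℝ E = Fintype.card ι) (hcard' : Module.finrank ℝ E = Fintype.card ι') :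
    ∑ i, ∑ j, metricForm g' (f x) (secondForm g g' f x (e i) (e j)) (secondForm g g' f x (e i) (e j))
      = ∑ i, ∑ j, metricForm g' (f x) (secondForm g g' f x (e' i) (e' j))
        (secondForm g g' f x (e' i) (e' j)) := by
  have h1 : ∀ u, ∑ j, metricForm g' (f x) (secondForm g g' f x u (e j)) (secondForm g g' f x u (e j))
      = ∑ j, metricForm g' (f x) (secondForm g g' f x u (e' j)) (secondForm g g' f x u (e' j)) :=
    fun u => he.trace_eq (metricForm_symm g x) he' hcard hcard'
      ((metricForm g' (f x)).compl₁₂ (secondForm g g' f x u).toLinearMap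
        (secondForm g g' f x u).toLinearMap)
  simp only [h1]
  rw [Finset.sum_comm]
  conv_rhs => rw [Finset.sum_comm]
  refine Finset.sum_congr rfl fun j _ => ?_
  exact he.trace_eq (metricForm_symm g x) he' hcard hcard'
      ((metricForm g' (f x)).compl₁₂ ((secondForm g g' f x).flip (e' j)).toLinearMap
        ((secondForm g g' f x).flip (e' j)).toLinearMap)

/-- The scalar curvature may be computed in any orthonormal frame. -/
theorem IsIsometricImmersion.scalarCurvature_eq (hf : IsIsometricImmersion g g' f)
    (hc : IsSpaceForm g' c) (x : M) {k : ℕ} (hk : Module.finrank ℝ E = k) {e : Fin k → E}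
    (he : IsOrthonormalFor (fun u v => metricForm g x u v) e) :
    scalarCurvature g x = ∑ i, ∑ j ∈ Finset.Ioi i, sectionalCurvature g x (e i) (e j) := by
  have he' : IsOrthonormalFor (fun u v => metricForm g x u v) (ι := Fin (Module.finrank ℝ E))
    (orthonormalFrame g x) := (exists_isOrthonormal g x).choose_spec
  have h1 := hf.sum_sectionalCurvature hc x he'
  rw [hf.sum_sectionalCurvature hc x he, sum_secondForm_eq x he he' (by simpa using hk) (by simp),
    sum_sq_secondForm_eq x he he' (by simpa using hk) (by simp), ← hk, ← h1]
  rfl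

omit [FiniteDimensional ℝ F] in
theorem smul_meanCurvatureVector (x : M) {k : ℕ} (hk : Module.finrank ℝ E = k) (hk0 : k ≠ 0)
    {e : Fin k → E} (he : IsOrthonormalFor (fun u v => metricForm g x u v) e) :
    (k : ℝ) • (show F from meanCurvatureVector g g' f x)
      = ∑ i, secondForm g g' f x (e i) (e i) := by
  have he' : IsOrthonormalFor (fun u v => metricForm g x u v) (ι := Fin (Module.finrank ℝ E))
    (orthonormalFrame g x) := (exists_isOrthonormal g x).choose_spec
  have hk' : (Module.finrank ℝ E : ℝ) = k := by rw [hk]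
  have h1 : (show F from meanCurvatureVector g g' f x) = (1 / (Module.finrank ℝ E : ℝ)) •
    ∑ i : Fin (Module.finrank ℝ E), secondForm g g' f x (show E from orthonormalFrame g x i)
      (show E from orthonormalFrame g x i) := rfl
  rw [h1, sum_secondForm_eq x he he' (by simpa using hk) (by simp), hk', smul_smul,
    mul_one_div_cancel (by exact_mod_cast hk0), one_smul]

end Submanifolds

section Inequality

variable {E : Type*} [NormedAddCommGroup E] [NormedSpace ℝ E] [FiniteDimensional ℝ E]
  {M : Type*} [TopologicalSpace M] [ChartedSpace E M] [IsManifold 𝓘(ℝ, E) ∞ M]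
  {F : Type*} [NormedAddCommGroup F] [NormedSpace ℝ F] [FiniteDimensional ℝ F]
  {N : Type*} [TopologicalSpace N] [ChartedSpace F N] [IsManifold 𝓘(ℝ, F) ∞ N]
  {g : SmoothMetric E M} {g' : SmoothMetric F N} {f : M → N}

omit [FiniteDimensional ℝ E] in
/-- The inner product of normal vectors in terms of a normal frame. -/
theorem IsIsometricImmersion.sum_normalFrame (hf : IsIsometricImmersion g g' f) {x : M}
    {ι κ : Type*} [Fintype ι] [Fintype κ]
    (hcard : Module.finrank ℝ F = Fintype.card ι + Fintype.card κ) {e : ι → E} {ξ : κ → F}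
    (he : IsOrthonormalFor (fun u v => metricForm g x u v) e)
    (hξ : IsOrthonormalFor (fun u v => metricForm g' (f x) u v) ξ)
    (hn : ∀ r (u : E), metricForm g' (f x) (differentialAt f x u) (ξ r) = 0) {v w : F}
    (hv : ∀ u : E, metricForm g' (f x) v (differentialAt f x u) = 0) :
    metricForm g' (f x) v w = ∑ r, metricForm g' (f x) v (ξ r) * metricForm g' (f x) w (ξ r) := by
  rw [← (hf.isOrthonormalFor_sumElim he hξ hn).sum_mul_eq (metricForm_symm g' (f x))
    (by rw [hcard, Fintype.card_sum]) v w, Fintype.sum_sum_type]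
  simp [hv]

/-- The inequality for a plane of an orthonormal frame, with its equality case. -/
theorem IsIsometricImmersion.frame_inequality (hf : IsIsometricImmersion g g' f) {c : ℝ}
    (hc : IsSpaceForm g' c) {x : M} {n l : ℕ} (hn : 3 ≤ n) (hE : Module.finrank ℝ E = n)
    (hF : Module.finrank ℝ F = n + l) {a : ℝ} (ha : a ∈ Set.Ioo (-1 : ℝ) 1) {e : Fin n → E}
    {ξ : Fin l → F} (he : IsOrthonormalFor (fun u v => metricForm g x u v) e)
    (hξ : IsOrthonormalFor (fun u v => metricForm g' (f x) u v) ξ)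
    (hnor : ∀ r (u : E), metricForm g' (f x) (differentialAt f x u) (ξ r) = 0) {i₀ i₁ : Fin n}
    (h₀ : (i₀ : ℕ) = 0) (h₁ : (i₁ : ℕ) = 1) {D bound : ℝ}
    (hD : D = scalarCurvature g x - a * sectionalCurvature g x (e i₀) (e i₁))
    (hb : bound = ((n : ℝ) ^ 2 - n - 2 * a) * c / 2
      + (n * (a + 1) - 3 * a - 1) / (n * (a + 1) - 2 * a)
        * ((n : ℝ) ^ 2 * metricForm g' (f x) (meanCurvatureVector g g' f x)
          (meanCurvatureVector g g' f x) / 2)) :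
    D ≤ bound ∧ (D = bound ↔ ∀ r,
      (weingartenMatrix g g' f x e (ξ r)).IsDiag ∧
        (a + 1) * weingartenMatrix g g' f x e (ξ r) i₀ i₀
          = (a + 1) * weingartenMatrix g g' f x e (ξ r) i₁ i₁ ∧
        ∀ i : Fin n, 2 ≤ (i : ℕ) → weingartenMatrix g g' f x e (ξ r) i i
          = (a + 1) * weingartenMatrix g g' f x e (ξ r) i₀ i₀) := by
  set h : Fin l → Fin n → Fin n → ℝ := fun r i j => weingartenMatrix g g' f x e (ξ r) i j with hh
  have hha : ∀ r i j, h r i j = metricForm g' (f x) (secondForm g g' f x (e i) (e j)) (ξ r) := by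
    intro r i j
    rw [metricForm_symm, hf.secondForm_symm]
    exact metricBilin_weingarten x (ξ r) (e j) (e i)
  have hsymm : ∀ r i j, h r i j = h r j i := fun r i j => by
    rw [hha, hha, hf.secondForm_symm]
  have hprod : ∀ i j p q, metricForm g' (f x) (secondForm g g' f x (e i) (e j))
      (secondForm g g' f x (e p) (e q)) = ∑ r, h r i j * h r p q := by
    intro i j p q
    simp only [hha]
    exact hf.sum_normalFrame (by simpa using hF) he hξ hnor
      fun u => hf.secondForm_normal x (e i) (e j) u
  have hK : ∀ i j, i ≠ j → sectionalCurvature g x (e i) (e j)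
      = c + ∑ r, (h r i i * h r j j - h r i j * h r i j) := by
    intro i j hij
    rw [hf.sectionalCurvature_spaceForm hc x (he.pair hij), hprod, hprod, Finset.sum_sub_distrib,
      add_sub_assoc]
  have hτ : scalarCurvature g x = ((n : ℝ) ^ 2 - n) * c / 2
      + ∑ r, ∑ i, ∑ j ∈ Finset.Ioi i, (h r i i * h r j j - h r i j * h r i j) := by
    rw [hf.scalarCurvature_eq hc x hE he, ← sum_Ioi_const n c, Finset.sum_comm,
      ← Finset.sum_add_distrib]
    refine Finset.sum_congr rfl fun i _ => ?_
    rw [Finset.sum_comm, ← Finset.sum_add_distrib]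
    exact Finset.sum_congr rfl fun j hj => hK i j (Finset.mem_Ioi.1 hj).ne
  have hH : (n : ℝ) ^ 2 * metricForm g' (f x) (meanCurvatureVector g g' f x)
      (meanCurvatureVector g g' f x) = ∑ r, (∑ i, h r i i) ^ 2 := by
    have h1 := smul_meanCurvatureVector (g' := g') (f := f) x hE (by omega) he
    have h2 : ∀ w : F, metricForm g' (f x) ((n : ℝ) • w) ((n : ℝ) • w)
        = (n : ℝ) ^ 2 * metricForm g' (f x) w w := fun w => by
      simp only [map_smul, LinearMap.smul_apply, smul_eq_mul]
      ring
    rw [← h2 (meanCurvatureVector g g' f x)]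
    refine (congrArg₂ (fun v w : F => metricForm g' (f x) v w) h1 h1).trans ?_
    simp only [map_sum, LinearMap.sum_apply, hprod, sq, Finset.sum_mul_sum]
    rw [Finset.sum_comm]
    simp only [Finset.sum_comm (γ := Fin l)]
  have hi : i₀ ≠ i₁ := fun h => by rw [h, h₁] at h₀; omega
  set κ := (n * (a + 1) - 3 * a - 1) / (n * (a + 1) - 2 * a) with hκ
  set Q : Fin l → ℝ := fun r => ∑ i, ∑ j ∈ Finset.Ioi i, (h r i i * h r j j - h r i j * h r i j)
      - a * (h r i₀ i₀ * h r i₁ i₁ - h r i₀ i₁ * h r i₀ i₁) with hQ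
  set R : Fin l → ℝ := fun r => κ * ((∑ i, h r i i) ^ 2 / 2) with hR
  have key := fun r => weingarten_inequality hn ha (h r) (hsymm r) h₀ h₁ (Q := Q r) (R := R r)
    rfl rfl
  have hDQ : D = ((n : ℝ) ^ 2 - n - 2 * a) * c / 2 + ∑ r, Q r := by
    rw [hD, hτ, hK i₀ i₁ hi, hQ]
    simp only [Finset.sum_sub_distrib, ← Finset.mul_sum]
    ring
  have hbR : bound = ((n : ℝ) ^ 2 - n - 2 * a) * c / 2 + ∑ r, R r := by
    rw [hb, hH, hR]
    simp only [← Finset.mul_sum, ← Finset.sum_div]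
  rw [hDQ, hbR]
  refine ⟨by linarith [Finset.sum_le_sum fun r (_ : r ∈ Finset.univ) => (key r).1], ?_⟩
  rw [add_right_inj, Finset.sum_eq_sum_iff_of_le fun r _ => (key r).1]
  refine ⟨fun H r => ?_, fun H r _ => ?_⟩
  · obtain ⟨k1, k2, k3⟩ := (key r).2.1 (H r (Finset.mem_univ r))
    exact ⟨fun i j hij => k1 i j hij, k2, k3⟩
  · obtain ⟨k1, k2, k3⟩ := H r
    exact (key r).2.2 ⟨fun i j hij => k1 hij, k2, k3⟩

omit [FiniteDimensional ℝ F] in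
theorem deltaInvariant_eq_max (hE : 2 ≤ Module.finrank ℝ E) (g : SmoothMetric E M) (x : M)
    (a : ℝ) :
    (∃ u v : E, IsOrthonormal g x ![u, v] ∧
      deltaInvariant a g x = scalarCurvature g x - a * sectionalCurvature g x u v) ∧
    ∀ u v : E, IsOrthonormal g x ![u, v] →
      scalarCurvature g x - a * sectionalCurvature g x u v ≤ deltaInvariant a g x := by
  obtain ⟨⟨k, hk⟩, ⟨K, hK⟩⟩ := exists_isLeast_isGreatest_sectionalCurvatures hE g x
  unfold deltaInvariant
  split_ifs with ha
  · rw [hk.csInf_eq]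
    refine ⟨?_, fun u v huv => ?_⟩
    · obtain ⟨u, v, huv, h⟩ := hk.1
      exact ⟨u, v, huv, by rw [h]⟩
    · have := mul_le_mul_of_nonneg_left (hk.2 ⟨u, v, huv, rfl⟩) ha
      linarith
  · rw [hK.csSup_eq]
    refine ⟨?_, fun u v huv => ?_⟩
    · obtain ⟨u, v, huv, h⟩ := hK.1
      exact ⟨u, v, huv, by rw [h]⟩
    · have := mul_le_mul_of_nonpos_left (hK.2 ⟨u, v, huv, rfl⟩) (not_le.1 ha).le
      linarith

end Inequality

theorem theorem3p1 (n m : ℕ) (hn : 3 ≤ n)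
    {M : Type*} [TopologicalSpace M] [ChartedSpace (EuclideanSpace ℝ (Fin n)) M]
    [IsManifold (𝓡 n) ∞ M]
    {N : Type*} [TopologicalSpace N] [ChartedSpace (EuclideanSpace ℝ (Fin m)) N]
    [IsManifold (𝓡 m) ∞ N]
    (g : SmoothMetric (EuclideanSpace ℝ (Fin n)) M)
    (g' : SmoothMetric (EuclideanSpace ℝ (Fin m)) N)
    (c : ℝ) (hc : IsSpaceForm g' c)
    (f : M → N) (hf : IsIsometricImmersion g g' f)
    (a : ℝ) (ha : a ∈ Set.Ioo (-1 : ℝ) 1) (x : M) :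
    let H := meanCurvatureVector g g' f x
    let bound : ℝ := ((n : ℝ) ^ 2 - n - 2 * a) * c / 2
      + (n * (a + 1) - 3 * a - 1) / (n * (a + 1) - 2 * a)
        * ((n : ℝ) ^ 2 * g'.inner (f x) H H / 2)
    deltaInvariant a g x ≤ bound ∧
    (deltaInvariant a g x = bound ↔
      ∃ (e : Fin n → TangentSpace (𝓡 n) x) (ξ : Fin (m - n) → TangentSpace (𝓡 m) (f x)),
        IsOrthonormal g x e ∧
        IsOrthonormal g' (f x) ξ ∧ (∀ r, IsNormal (EuclideanSpace ℝ (Fin n)) g' f x (ξ r)) ∧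
        ∀ r, let h := weingartenMatrix g g' f x e (ξ r)
          h.IsDiag ∧
          (a + 1) * h ⟨0, by omega⟩ ⟨0, by omega⟩ = (a + 1) * h ⟨1, by omega⟩ ⟨1, by omega⟩ ∧
          ∀ i : Fin n, 2 ≤ (i : ℕ) → h i i = (a + 1) * h ⟨0, by omega⟩ ⟨0, by omega⟩) := by

  intro H bound
  have hE : Module.finrank ℝ (EuclideanSpace ℝ (Fin n)) = n := finrank_euclideanSpace_fin
  have hle := hf.finrank_le x
  rw [finrank_euclideanSpace_fin, finrank_euclideanSpace_fin] at hle
  have hF : Module.finrank ℝ (EuclideanSpace ℝ (Fin m)) = n + (m - n) := by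
    rw [finrank_euclideanSpace_fin]; omega
  obtain ⟨⟨u, v, huv, hδ⟩, hmax⟩ := deltaInvariant_eq_max (by omega) g x a
  obtain ⟨e, he, rfl, rfl⟩ := exists_orthonormalFrame_pair hE x huv
    (i := ⟨0, by omega⟩) (j := ⟨1, by omega⟩) (by simp)
  obtain ⟨ξ, hξ, hnor⟩ := hf.exists_normalFrame hE hF he
  have key := hf.frame_inequality hc hn hE hF ha he hξ hnor
    (i₀ := ⟨0, by omega⟩) (i₁ := ⟨1, by omega⟩) rfl rfl hδ (bound := bound) rfl
  refine ⟨key.1, fun h => ⟨e, ξ, he, hξ, hnor, key.2.1 h⟩, ?_⟩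
  rintro ⟨e, ξ, he, hξ, hnor, h⟩
  have key' := hf.frame_inequality hc hn hE hF ha he hξ hnor
    (i₀ := ⟨0, by omega⟩) (i₁ := ⟨1, by omega⟩) rfl rfl rfl (bound := bound) rfl
  exact le_antisymm key.1 ((key'.2.2 h).symm.le.trans
    (hmax _ _ (IsOrthonormalFor.pair (E := EuclideanSpace ℝ (Fin n)) he (by simp))))
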